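/- Let $\mathcal P_1(\mathbb R)$ be the set of probability measures on $\mathbb R$ with finite first moment. For $\mu,\nu\in\mathcal P_1(\mathbb R)$ let $\Pi(\mu,\nu)$ be the set of couplings of $\mu$ and $\nu$, and let $\Pi^{\mathrm M}(\mu,\nu)$ be the set of martingale couplings, i.e. of those $M(dx,dy)=\mu(dx)\,m(x,dy)$ in $\Pi(\mu,\nu)$, with $m$ a Markov kernel, such that for $\mu$-a.e. $x$, $\int|y|\,m(x,dy)<\infty$ and $\int y\,m(x,dy)=x$. Put $$W_1(\mu,\nu)=\inf_{P\in\Pi(\mu,\nu)}\int|x-y|\,P(dx,dy),\qquad \mathcal M_1(\mu,\nu)=\inf_{M\in\Pi^{\mathrm M}(\mu,\nu)}\int|x-y|\,M(dx,dy).$$ Write $\mu<_{cx}\nu$ if $\mu\ne\nu$ and $\int f\,d\mu\le\int f\,d\nu$ (in $(-\infty,+\infty]$) for every convex $f:\mathbb R\to\mathbb R$. Let $F_\eta(x)=\eta((-\infty,x])$, let $F_\eta(x_-)$ be its left limit at $x$, and let $F_\eta^{-1}(u)=\inf\{x\in\mathbb R: F_\eta(x)\ge u\}$ for $u\in(0,1)$.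 Let $\mu,\nu\in\mathcal P_1(\mathbb R)$ with $\mu<_{cx}\nu$. Put $\mathcal U_+=\{u\in(0,1):F_\mu^{-1}(u)>F_\nu^{-1}(u)\}$, $\mathcal U_-=\{u\in(0,1):F_\mu^{-1}(u)<F_\nu^{-1}(u)\}$ and $\gamma=\int_0^1(F_\mu^{-1}-F_\nu^{-1})^+(u)\,du$. Let $\mathcal Q$ be the set of probability measures $Q$ on $(0,1)^2$ with first marginal $\frac1\gamma(F_\mu^{-1}-F_\nu^{-1})^+(u)\,du$, second marginal $\frac1\gamma(F_\mu^{-1}-F_\nu^{-1})^-(v)\,dv$, and $Q(\{(u,v):u<v\})=1$. For $Q\in\mathcal Q$ let $\pi_+,\pi_-$ be any sub-Markov kernels on $(0,1)$ such that $\pi_+(u,(0,1))=1$ for a.e. $u\in\mathcal U_+$, $\pi_-(v,(0,1))=1$ for a.e. $v\in\mathcal U_-$, and $$Q(du,dv)=\tfrac1\gamma(F_\mu^{-1}-F_\nu^{-1})^+(u)\,du\,\pi_+(u,dv)=\tfrac1\gamma(F_\mu^{-1}-F_\nu^{-1})^-(v)\,dv\,\pi_-(v,du).$$ For $u\in(0,1)$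 and $\pi\in\{\pi_+,\pi_-\}$ set $$S_\pi(u,dy)=\int\frac{F_\mu^{-1}(u)-F_\nu^{-1}(u)}{F_\nu^{-1}(v)-F_\nu^{-1}(u)}\,\delta_{F_\nu^{-1}(v)}(dy)\,\pi(u,dv)+\left(\int\frac{F_\nu^{-1}(v)-F_\mu^{-1}(u)}{F_\nu^{-1}(v)-F_\nu^{-1}(u)}\,\pi(u,dv)\right)\delta_{F_\nu^{-1}(u)}(dy).$$ Let $\widetilde m^Q(u,\cdot)$ be $S_{\pi_+}(u,\cdot)$ if $u\in\mathcal U_+$ and $\pi_+(u,\{v\in(0,1):F_\nu^{-1}(v)>F_\mu^{-1}(u)\})=1$; $S_{\pi_-}(u,\cdot)$ if $u\in\mathcal U_-$ and $\pi_-(u,\{v\in(0,1):F_\nu^{-1}(v)<F_\mu^{-1}(u)\})=1$; and $\delta_{F_\nu^{-1}(u)}$ otherwise. Let $m^Q(x,\cdot)$ be $\delta_x$ if $F_\mu(x)=0$ or $F_\mu(x_-)=1$; $\frac1{\mu(\{x\})}\int_{F_\mu(x_-)}^{F_\mu(x)}\widetilde m^Q(u,\cdot)\,du$ if $\mu(\{x\})>0$;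 and $\widetilde m^Q(F_\mu(x),\cdot)$ otherwise. Finally let $M^Q(dx,dy)=\mu(dx)\,m^Q(x,dy)$. **Theorem.** (1) For all $\mu,\nu\in\mathcal P_1(\mathbb R)$ with $\mu<_{cx}\nu$: the set $\mathcal Q$ is non-empty; for every $Q\in\mathcal Q$ kernels $\pi_+,\pi_-$ as above exist, and for every choice of them $$\int_{\mathbb R\times\mathbb R}|x-y|\,M^Q(dx,dy)\le 2\,W_1(\mu,\nu);$$ consequently $\mathcal M_1(\mu,\nu)\le 2\,W_1(\mu,\nu)$. (2) The constant $2$ is sharp: $$\sup_{\mu,\nu\in\mathcal P_1(\mathbb R),\ \mu<_{cx}\nu}\frac{\mathcal M_1(\mu,\nu)}{W_1(\mu,\nu)}=2.$$ It is sharp already for symmetric two-point marginals: for every $c<2$ there are $0<a<b$ such that $\mu=\frac12\delta_{-a}+\frac12\delta_a$ and $\nu=\frac12\delta_{-b}+\frac12\delta_b$ satisfy $\mu<_{cx}\nu$ and $\mathcal M_1(\mu,\nu)>c\,W_1(\mu,\nu)$. -/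

import Mathlib

open MeasureTheory ProbabilityTheory Set
open scoped ENNReal

noncomputable section

namespace MartingaleStability

/-! ### Couplings, transport costs, convex order -/

/-- `P₁(ℝ)`: probability measures on the line with finite first moment. -/
def FiniteFirstMoment (η : Measure ℝ) : Prop :=
  IsProbabilityMeasure η ∧ Integrable (fun x : ℝ => x) η

/-- `Π(μ, ν)`: the couplings of `μ` and `ν`. -/
def couplings (μ ν : Measure ℝ) : Set (Measure (ℝ × ℝ)) :=
  {P | P.map Prod.fst = μ ∧ P.map Prod.snd = ν}

/-- `Π^M(μ, ν)`: the martingale couplings, i.e. the couplings `M(dx, dy) = μ(dx) m(x, dy)` such that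
for `μ`-almost every `x` the measure `m(x, ·)` is integrable with mean `x`. -/
def martingaleCouplings (μ ν : Measure ℝ) : Set (Measure (ℝ × ℝ)) :=
  {M | M ∈ couplings μ ν ∧ ∃ m : Kernel ℝ ℝ, IsMarkovKernel m ∧ M = μ ⊗ₘ m ∧
    ∀ᵐ x ∂μ, Integrable (fun y : ℝ => y) (m x) ∧ ∫ y, y ∂(m x) = x}

/-- The cost `∫ |x - y| P(dx, dy)`, with values in `[0, ∞]`. -/
def cost (P : Measure (ℝ × ℝ)) : ℝ≥0∞ :=
  ∫⁻ p, ENNReal.ofReal |p.1 - p.2| ∂P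

/-- The Wasserstein distance `W₁(μ, ν)`. -/
def W₁ (μ ν : Measure ℝ) : ℝ≥0∞ := ⨅ P ∈ couplings μ ν, cost P

/-- The minimal cost `𝓜₁(μ, ν)` over martingale couplings. -/
def M₁ (μ ν : Measure ℝ) : ℝ≥0∞ := ⨅ M ∈ martingaleCouplings μ ν, cost M

/-- The convex order on `P₁(ℝ)`. For a convex `f` and `η ∈ P₁(ℝ)` the integral `∫ f dη` makes sense
in `(-∞, ∞]`, and it is finite exactly when `f` is `η`-integrable; so `∫ f dμ ≤ ∫ f dν` in
`(-∞, ∞]` says that if `f` is `ν`-integrable then it is `μ`-integrable and the inequality holds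
between the real integrals. -/
def ConvexOrder (μ ν : Measure ℝ) : Prop :=
  ∀ f : ℝ → ℝ, ConvexOn ℝ univ f → Integrable f ν →
    Integrable f μ ∧ ∫ x, f x ∂μ ≤ ∫ x, f x ∂ν

/-- The strict convex order `μ <_cx ν`. -/
def StrictConvexOrder (μ ν : Measure ℝ) : Prop :=
  ConvexOrder μ ν ∧ μ ≠ ν

/-- The symmetric two-point measure `½ δ_{-a} + ½ δ_a`. -/
def symmTwoPoint (a : ℝ) : Measure ℝ :=
  (2 : ℝ≥0∞)⁻¹ • Measure.dirac (-a) + (2 : ℝ≥0∞)⁻¹ • Measure.dirac a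

/-! ### Quantile functions and the set `𝒬` -/

/-- The quantile function `F_η⁻¹(u) = inf {x | F_η(x) ≥ u}`, meaningful for `u ∈ (0, 1)`. -/
def quantile (η : Measure ℝ) (u : ℝ) : ℝ := sInf {x : ℝ | u ≤ cdf η x}

/-- `𝒰₊ = {u ∈ (0, 1) | F_μ⁻¹(u) > F_ν⁻¹(u)}`. -/
def Uplus (μ ν : Measure ℝ) : Set ℝ := {u | u ∈ Ioo (0 : ℝ) 1 ∧ quantile ν u < quantile μ u}

/-- `𝒰₋ = {u ∈ (0, 1) | F_μ⁻¹(u) < F_ν⁻¹(u)}`. -/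
def Uminus (μ ν : Measure ℝ) : Set ℝ := {u | u ∈ Ioo (0 : ℝ) 1 ∧ quantile μ u < quantile ν u}

/-- `γ = ∫₀¹ (F_μ⁻¹ - F_ν⁻¹)⁺(u) du`; here `ENNReal.ofReal` takes the positive part. -/
def gam (μ ν : Measure ℝ) : ℝ≥0∞ :=
  ∫⁻ u in Ioo (0 : ℝ) 1, ENNReal.ofReal (quantile μ u - quantile ν u)

/-- The measure `γ⁻¹ (F_μ⁻¹ - F_ν⁻¹)⁺(u) du` on `(0, 1)`. -/
def plusMarginal (μ ν : Measure ℝ) : Measure ℝ :=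
  (volume.restrict (Ioo (0 : ℝ) 1)).withDensity
    (fun u => ENNReal.ofReal (quantile μ u - quantile ν u) / gam μ ν)

/-- The measure `γ⁻¹ (F_μ⁻¹ - F_ν⁻¹)⁻(v) dv` on `(0, 1)`. -/
def minusMarginal (μ ν : Measure ℝ) : Measure ℝ :=
  (volume.restrict (Ioo (0 : ℝ) 1)).withDensity
    (fun v => ENNReal.ofReal (quantile ν v - quantile μ v) / gam μ ν)

/-- The set `𝒬` attached to `μ` and `ν`. A probability measure on `(0, 1)²` is seen as one on `ℝ²`;
the two marginal conditions force it to be carried by `(0, 1)²`. -/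
def calQ (μ ν : Measure ℝ) : Set (Measure (ℝ × ℝ)) :=
  {Q | IsProbabilityMeasure Q ∧ Q.map Prod.fst = plusMarginal μ ν ∧
    Q.map Prod.snd = minusMarginal μ ν ∧ Q {p | p.1 < p.2} = 1}

/-- A choice of the two sub-Markov kernels `π₊`, `π₋` on `(0, 1)` (extended to the line) with
`Q(du, dv) = γ⁻¹ (F_μ⁻¹ - F_ν⁻¹)⁺(u) du π₊(u, dv) = γ⁻¹ (F_μ⁻¹ - F_ν⁻¹)⁻(v) dv π₋(v, du)`. -/
structure Disintegration (μ ν : Measure ℝ) (Q : Measure (ℝ × ℝ)) where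
  piPlus : Kernel ℝ ℝ
  piMinus : Kernel ℝ ℝ
  plus_le_one : ∀ u, piPlus u univ ≤ 1
  minus_le_one : ∀ v, piMinus v univ ≤ 1
  plus_compl : ∀ u, piPlus u (Ioo (0 : ℝ) 1)ᶜ = 0
  minus_compl : ∀ v, piMinus v (Ioo (0 : ℝ) 1)ᶜ = 0
  plus_eq_one : ∀ᵐ u ∂(volume.restrict (Uplus μ ν)), piPlus u (Ioo (0 : ℝ) 1) = 1
  minus_eq_one : ∀ᵐ v ∂(volume.restrict (Uminus μ ν)), piMinus v (Ioo (0 : ℝ) 1) = 1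
  eq_plus : Q = plusMarginal μ ν ⊗ₘ piPlus
  eq_minus : Q = (minusMarginal μ ν ⊗ₘ piMinus).map Prod.swap

/-! ### Measurability of the quantile function -/

theorem quantile_monotoneOn (η : Measure ℝ) : MonotoneOn (quantile η) (Ioo (0 : ℝ) 1) := by
  intro u hu v hv huv
  refine csInf_le_csInf ?_ ?_ (fun x hx => le_trans huv hx)
  · obtain ⟨y, hy⟩ := ((tendsto_cdf_atBot η).eventually (gt_mem_nhds hu.1)).exists
    refine ⟨y, fun x hx => ?_⟩
    by_contra h
    exact absurd (hx.trans (monotone_cdf η (not_le.1 h).le)) (not_le.2 hy)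
  · obtain ⟨y, hy⟩ := ((tendsto_cdf_atTop η).eventually (lt_mem_nhds hv.2)).exists
    exact ⟨y, hy.le⟩

theorem quantile_of_nonpos (η : Measure ℝ) {u : ℝ} (hu : u ≤ 0) : quantile η u = 0 := by
  have : {x : ℝ | u ≤ cdf η x} = univ := eq_univ_of_forall fun x => hu.trans (cdf_nonneg η x)
  simp [quantile, this]

theorem quantile_of_one_lt (η : Measure ℝ) {u : ℝ} (hu : 1 < u) : quantile η u = 0 := by
  have : {x : ℝ | u ≤ cdf η x} = ∅ :=
    eq_empty_of_forall_notMem fun x hx => absurd (hx.trans (cdf_le_one η x)) (not_le.2 hu)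
  simp [quantile, this]

theorem measurable_quantile (η : Measure ℝ) : Measurable (quantile η) := by
  refine measurable_of_restrict_of_restrict_compl (s := Ioo (0 : ℝ) 1) measurableSet_Ioo ?_ ?_
  · have : Monotone ((Ioo (0 : ℝ) 1).domRestrict (quantile η)) :=
      fun u v huv => quantile_monotoneOn η u.2 v.2 huv
    exact this.measurable
  · have : (Ioo (0 : ℝ) 1)ᶜ.domRestrict (quantile η)
        = (Ioo (0 : ℝ) 1)ᶜ.domRestrict (fun u => if u = 1 then quantile η 1 else 0) := by
      funext ⟨u, hu⟩
      simp only [domRestrict_apply]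
      split_ifs with h
      · rw [h]
      · by_cases h0 : u ≤ 0
        · exact quantile_of_nonpos η h0
        · refine quantile_of_one_lt η (lt_of_le_of_ne ?_ (Ne.symm h))
          by_contra h1
          exact hu ⟨not_le.1 h0, not_le.1 h1⟩
    rw [this]
    have hm : Measurable (fun u : ℝ => if u = 1 then quantile η 1 else 0) :=
      Measurable.ite (measurableSet_singleton 1) measurable_const measurable_const
    exact hm.comp measurable_subtype_coe

/-! ### The kernel `m̃^Q` -/

/-- For a measure `ρ(dv)`, the measure
`∫ (F_μ⁻¹(u) - F_ν⁻¹(u)) / (F_ν⁻¹(v) - F_ν⁻¹(u)) δ_{F_ν⁻¹(v)} ρ(dv)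
  + (∫ (F_ν⁻¹(v) - F_μ⁻¹(u)) / (F_ν⁻¹(v) - F_ν⁻¹(u)) ρ(dv)) δ_{F_ν⁻¹(u)}`.
It is used only where both quotients are nonnegative for `ρ`-almost every `v`. -/
def splitMeasure (μ ν : Measure ℝ) (ρ : Measure ℝ) (u : ℝ) : Measure ℝ :=
  (ρ.withDensity (fun v => ENNReal.ofReal
      ((quantile μ u - quantile ν u) / (quantile ν v - quantile ν u)))).map (quantile ν)
    + (∫⁻ v, ENNReal.ofReal
      ((quantile ν v - quantile μ u) / (quantile ν v - quantile ν u)) ∂ρ) •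
      Measure.dirac (quantile ν u)

/-- The set of `u ∈ 𝒰₊` with `π(u, {v ∈ (0, 1) | F_ν⁻¹(v) > F_μ⁻¹(u)}) = 1`. -/
def goodPlus (μ ν : Measure ℝ) (π : Kernel ℝ ℝ) : Set ℝ :=
  {u | u ∈ Uplus μ ν ∧ π u {v | v ∈ Ioo (0 : ℝ) 1 ∧ quantile μ u < quantile ν v} = 1}

/-- The set of `u ∈ 𝒰₋` with `π(u, {v ∈ (0, 1) | F_ν⁻¹(v) < F_μ⁻¹(u)}) = 1`. -/
def goodMinus (μ ν : Measure ℝ) (π : Kernel ℝ ℝ) : Set ℝ :=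
  {u | u ∈ Uminus μ ν ∧ π u {v | v ∈ Ioo (0 : ℝ) 1 ∧ quantile ν v < quantile μ u} = 1}

theorem measurableSet_goodPlus (μ ν : Measure ℝ) (π : Kernel ℝ ℝ) [IsFiniteKernel π] :
    MeasurableSet (goodPlus μ ν π) := by
  have hμ := measurable_quantile μ
  have hν := measurable_quantile ν
  refine MeasurableSet.inter (measurableSet_Ioo.inter (measurableSet_lt hν hμ)) ?_
  have hs : MeasurableSet {p : ℝ × ℝ | p.2 ∈ Ioo (0 : ℝ) 1 ∧ quantile μ p.1 < quantile ν p.2} :=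
    (measurable_snd measurableSet_Ioo).inter
      (measurableSet_lt (hμ.comp measurable_fst) (hν.comp measurable_snd))
  exact Kernel.measurable_kernel_prodMk_left hs (measurableSet_singleton 1)

theorem measurableSet_goodMinus (μ ν : Measure ℝ) (π : Kernel ℝ ℝ) [IsFiniteKernel π] :
    MeasurableSet (goodMinus μ ν π) := by
  have hμ := measurable_quantile μ
  have hν := measurable_quantile ν
  refine MeasurableSet.inter (measurableSet_Ioo.inter (measurableSet_lt hμ hν)) ?_
  have hs : MeasurableSet {p : ℝ × ℝ | p.2 ∈ Ioo (0 : ℝ) 1 ∧ quantile ν p.2 < quantile μ p.1} :=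
    (measurable_snd measurableSet_Ioo).inter
      (measurableSet_lt (hν.comp measurable_snd) (hμ.comp measurable_fst))
  exact Kernel.measurable_kernel_prodMk_left hs (measurableSet_singleton 1)

theorem measurable_splitMeasure (μ ν : Measure ℝ) (π : Kernel ℝ ℝ) [IsFiniteKernel π] :
    Measurable (fun u => splitMeasure μ ν (π u) u) := by
  have hμ := measurable_quantile μ
  have hν := measurable_quantile ν
  refine Measure.measurable_of_measurable_coe _ fun s hs => ?_
  have h1 : Measurable (fun p : ℝ × ℝ => ENNReal.ofReal
      ((quantile μ p.1 - quantile ν p.1) / (quantile ν p.2 - quantile ν p.1))) := by fun_prop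
  have h2 : Measurable (fun p : ℝ × ℝ => ENNReal.ofReal
      ((quantile ν p.2 - quantile μ p.1) / (quantile ν p.2 - quantile ν p.1))) := by fun_prop
  have key : ∀ u, splitMeasure μ ν (π u) u s
      = (∫⁻ v in quantile ν ⁻¹' s, ENNReal.ofReal
          ((quantile μ u - quantile ν u) / (quantile ν v - quantile ν u)) ∂(π u))
        + (∫⁻ v, ENNReal.ofReal
          ((quantile ν v - quantile μ u) / (quantile ν v - quantile ν u)) ∂(π u)) *
          s.indicator 1 (quantile ν u) := by
    intro u
    rw [splitMeasure, Measure.add_apply, Measure.map_apply hν hs,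
      withDensity_apply _ (hν hs), Measure.smul_apply, smul_eq_mul, Measure.dirac_apply' _ hs]
  simp_rw [key]
  refine Measurable.add ?_ (Measurable.mul ?_ ?_)
  · exact h1.setLIntegral_kernel_prod_right (hν hs)
  · exact h2.lintegral_kernel_prod_right
  · exact (measurable_one.indicator hs).comp hν

theorem splitMeasure_univ (μ ν : Measure ℝ) (ρ : Measure ℝ) (u : ℝ) (hρ : ρ univ = 1)
    (h : ∀ᵐ v ∂ρ, (quantile ν u < quantile μ u ∧ quantile μ u < quantile ν v) ∨
      (quantile μ u < quantile ν u ∧ quantile ν v < quantile μ u)) :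
    splitMeasure μ ν ρ u univ = 1 := by
  have hν := measurable_quantile ν
  rw [splitMeasure, Measure.add_apply, Measure.map_apply hν MeasurableSet.univ, preimage_univ,
    withDensity_apply _ MeasurableSet.univ, Measure.restrict_univ, Measure.smul_apply,
    smul_eq_mul, measure_univ, mul_one, ← lintegral_add_left (by fun_prop), ← hρ,
    ← lintegral_one]
  refine lintegral_congr_ae (h.mono fun v hv => ?_)
  have hne : quantile ν v - quantile ν u ≠ 0 := by
    rcases hv with hv | hv
    · exact (sub_pos.2 (hv.1.trans hv.2)).ne'
    · exact (sub_neg.2 (hv.2.trans hv.1)).ne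
  have h1 : 0 ≤ (quantile μ u - quantile ν u) / (quantile ν v - quantile ν u) := by
    rcases hv with hv | hv
    · exact div_nonneg (by linarith) (by linarith)
    · exact div_nonneg_of_nonpos (by linarith) (by linarith)
  have h2 : 0 ≤ (quantile ν v - quantile μ u) / (quantile ν v - quantile ν u) := by
    rcases hv with hv | hv
    · exact div_nonneg (by linarith) (by linarith)
    · exact div_nonneg_of_nonpos (by linarith) (by linarith)
  have h3 : (quantile μ u - quantile ν u) / (quantile ν v - quantile ν u)
      + (quantile ν v - quantile μ u) / (quantile ν v - quantile ν u) = 1 := by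
    rw [← add_div, div_eq_one_iff_eq hne]
    ring
  simp only
  rw [← ENNReal.ofReal_add h1 h2, h3, ENNReal.ofReal_one]

variable {μ ν : Measure ℝ} {Q : Measure (ℝ × ℝ)}

instance (D : Disintegration μ ν Q) : IsFiniteKernel D.piPlus :=
  ⟨⟨1, ENNReal.one_lt_top, D.plus_le_one⟩⟩

instance (D : Disintegration μ ν Q) : IsFiniteKernel D.piMinus :=
  ⟨⟨1, ENNReal.one_lt_top, D.minus_le_one⟩⟩

open scoped Classical in
/-- The kernel `m̃^Q(u, dy)` (relevant for `u ∈ (0, 1)`). -/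
def mTilde (D : Disintegration μ ν Q) : Kernel ℝ ℝ where
  toFun u :=
    if u ∈ goodPlus μ ν D.piPlus then splitMeasure μ ν (D.piPlus u) u
    else if u ∈ goodMinus μ ν D.piMinus then splitMeasure μ ν (D.piMinus u) u
    else Measure.dirac (quantile ν u)
  measurable' := by
    refine Measurable.ite (measurableSet_goodPlus μ ν D.piPlus)
      (measurable_splitMeasure μ ν D.piPlus) ?_
    exact Measurable.ite (measurableSet_goodMinus μ ν D.piMinus)
      (measurable_splitMeasure μ ν D.piMinus)
      (Measure.measurable_dirac.comp (measurable_quantile ν))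

instance (D : Disintegration μ ν Q) : IsMarkovKernel (mTilde D) := by
  classical
  refine ⟨fun u => ⟨?_⟩⟩
  have hμ := measurable_quantile μ
  have hν := measurable_quantile ν
  have aux : ∀ (ρ : Measure ℝ) (s : Set ℝ), MeasurableSet s → ρ univ ≤ 1 → ρ s = 1 →
      ρ univ = 1 ∧ ∀ᵐ v ∂ρ, v ∈ s := by
    intro ρ s hs h1 h2
    have h3 : ρ univ = 1 := le_antisymm h1 (h2 ▸ measure_mono (subset_univ s))
    have : IsProbabilityMeasure ρ := ⟨h3⟩
    exact ⟨h3, (mem_ae_iff_prob_eq_one hs).2 h2⟩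
  change (if u ∈ goodPlus μ ν D.piPlus then splitMeasure μ ν (D.piPlus u) u
    else if u ∈ goodMinus μ ν D.piMinus then splitMeasure μ ν (D.piMinus u) u
    else Measure.dirac (quantile ν u)) univ = 1
  split_ifs with h h'
  · obtain ⟨a, b⟩ := aux _ _ (measurableSet_Ioo.inter (measurableSet_lt measurable_const hν))
      (D.plus_le_one u) h.2
    exact splitMeasure_univ μ ν _ u a (b.mono fun v hv => Or.inl ⟨h.1.2, hv.2⟩)
  · obtain ⟨a, b⟩ := aux _ _ (measurableSet_Ioo.inter (measurableSet_lt hν measurable_const))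
      (D.minus_le_one u) h'.2
    exact splitMeasure_univ μ ν _ u a (b.mono fun v hv => Or.inr ⟨h'.1.2, hv.2⟩)
  · exact measure_univ

/-! ### The kernel `m^Q` and the coupling `M^Q` -/

theorem cdf_sub_leftLim (μ : Measure ℝ) [IsProbabilityMeasure μ] (x : ℝ) :
    ENNReal.ofReal (cdf μ x - Function.leftLim (cdf μ) x) = μ {x} := by
  conv_rhs => rw [← measure_cdf μ]
  rw [StieltjesFunction.measure_singleton]

open scoped Classical in
/-- The kernel `m(x, dy)` on the line attached to `μ` and to a Markov kernel `m̃(u, dy)`: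
it is `δ_x` if `F_μ(x) = 0` or `F_μ(x-) = 1`, the average of `m̃(u, ·)` over
`u ∈ (F_μ(x-), F_μ(x)]` if `x` is an atom of `μ`, and `m̃(F_μ(x), ·)` otherwise. -/
def lineKernel (μ : Measure ℝ) [IsProbabilityMeasure μ] (k : Kernel ℝ ℝ) [IsMarkovKernel k] :
    Kernel ℝ ℝ where
  toFun x :=
    if cdf μ x = 0 ∨ Function.leftLim (cdf μ) x = 1 then Measure.dirac x
    else if 0 < μ {x} then
      (μ {x})⁻¹ • (volume.restrict (Ioc (Function.leftLim (cdf μ) x) (cdf μ x))).bind k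
    else k (cdf μ x)
  measurable' := by
    have hF : Measurable (cdf μ) := (monotone_cdf μ).measurable
    have hL : Measurable (Function.leftLim (cdf μ)) := (monotone_cdf μ).leftLim.measurable
    have hA : Measurable (fun x : ℝ => μ {x}) := by
      simp_rw [← cdf_sub_leftLim μ]
      fun_prop
    refine Measurable.ite ((hF (measurableSet_singleton 0)).union (hL (measurableSet_singleton 1)))
      Measure.measurable_dirac ?_
    refine Measurable.ite (measurableSet_lt measurable_const hA) ?_ (k.measurable.comp hF)
    refine Measure.measurable_of_measurable_coe _ fun s hs => ?_
    have key : ∀ x : ℝ, ((μ {x})⁻¹ •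
        (volume.restrict (Ioc (Function.leftLim (cdf μ) x) (cdf μ x))).bind k) s
        = (μ {x})⁻¹ * ∫⁻ u, {p : ℝ × ℝ | Function.leftLim (cdf μ) p.1 < p.2 ∧
            p.2 ≤ cdf μ p.1}.indicator (fun p => k p.2 s) (x, u) := by
      intro x
      rw [Measure.smul_apply, smul_eq_mul, Measure.bind_apply hs k.measurable.aemeasurable,
        ← lintegral_indicator measurableSet_Ioc]
      rfl
    simp_rw [key]
    refine hA.inv.mul (Measurable.lintegral_prod_right' (Measurable.indicator ?_ ?_))
    · exact (k.measurable_coe hs).comp measurable_snd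
    · exact (measurableSet_lt (hL.comp measurable_fst) measurable_snd).inter
        (measurableSet_le measurable_snd (hF.comp measurable_fst))

instance (μ : Measure ℝ) [IsProbabilityMeasure μ] (k : Kernel ℝ ℝ) [IsMarkovKernel k] :
    IsMarkovKernel (lineKernel μ k) := by
  classical
  refine ⟨fun x => ⟨?_⟩⟩
  change (if cdf μ x = 0 ∨ Function.leftLim (cdf μ) x = 1 then Measure.dirac x
    else if 0 < μ {x} then
      (μ {x})⁻¹ • (volume.restrict (Ioc (Function.leftLim (cdf μ) x) (cdf μ x))).bind k
    else k (cdf μ x)) univ = 1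
  split_ifs with h h'
  · exact measure_univ
  · rw [Measure.smul_apply, smul_eq_mul, Measure.bind_apply MeasurableSet.univ
      k.measurable.aemeasurable]
    simp only [measure_univ, lintegral_one, Measure.restrict_apply MeasurableSet.univ, univ_inter,
      Real.volume_Ioc, cdf_sub_leftLim]
    exact ENNReal.inv_mul_cancel h'.ne' (measure_ne_top _ _)
  · exact measure_univ

/-- The coupling `M^Q(dx, dy) = μ(dx) m^Q(x, dy)`. -/
def MQ [IsProbabilityMeasure μ] (D : Disintegration μ ν Q) : Measure (ℝ × ℝ) :=
  μ ⊗ₘ lineKernel μ (mTilde D)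

end MartingaleStability

end

open MartingaleStability

/-! Everything is computed on `(0, 1)` with Lebesgue measure, where `quantile μ` and `quantile ν`
have laws `μ` and `ν`. `compProd_lineKernel` identifies `μ ⊗ₘ lineKernel μ k` with the image of `du
k(u, dy)` under `quantile μ` in the first coordinate, so only `mTilde` has to be studied.

Upper bound. Put `x = F_μ⁻¹(u)`, `a = F_ν⁻¹(u)`, `b = F_ν⁻¹(v)`. If `x` lies strictly between `a`
and `b`, the law on `{a, b}` with mean `x` costs `2|x - a||b - x| / |b - a| ≤ 2|x - a|`. Integrating
in `u` gives `2 ∫ |F_μ⁻¹ - F_ν⁻¹|`, and this integral is at most `W₁ μ ν` by a layer-cake argument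
(`lintegral_abs_quantile_sub_le_W₁`).

Martingale coupling. For `Q`-almost every `(u, v)`, `u < v` and monotonicity give `F_ν⁻¹(u) <
F_μ⁻¹(u) ≤ F_μ⁻¹(v) < F_ν⁻¹(v)`, so splitting is possible at both `u` and `v`. Relative to
`δ_{F_ν⁻¹(u)} du`, the plus kernel moves mass `γ Q(du, dv) / |F_ν⁻¹(v) - F_ν⁻¹(u)|` from `F_ν⁻¹(u)`
to `F_ν⁻¹(v)`, and the minus kernel moves the same mass back; hence the second marginal is `ν`
(`bind_mTilde`).

Existence of `Q`. Convex order says that `∫₀ᵘ F_ν⁻¹ ≤ ∫₀ᵘ F_μ⁻¹`, with equality at `u = 1`; so the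
minus marginal stochastically dominates the plus marginal and their comonotone coupling is
admissible (`calQ_nonempty`).

Sharpness. From `±a` to `±1` every martingale coupling costs `1 - a²`, while `W₁` is at most `1 -
a`; the ratio is at least `1 + a`, which tends to `2` as `a → 1`. -/

namespace MartingaleStability

variable {μ ν : Measure ℝ} {Q : Measure (ℝ × ℝ)}

/-! ### Quantile functions -/

/-- The Lebesgue measure on `(0, 1)`. -/
noncomputable abbrev unitLebesgue : Measure ℝ := volume.restrict (Ioo (0 : ℝ) 1)

instance : IsProbabilityMeasure unitLebesgue := ⟨by simp [unitLebesgue]⟩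

/-- Right continuity of the cdf makes the infimum attained; `0 < u < 1` makes the defining set
bounded below and nonempty. -/
theorem quantile_le_iff (η : Measure ℝ) {u : ℝ} (hu : u ∈ Ioo (0 : ℝ) 1) (x : ℝ) :
    quantile η u ≤ x ↔ u ≤ cdf η x := by
  have hb : BddBelow {x : ℝ | u ≤ cdf η x} := by
    obtain ⟨y, hy⟩ := ((tendsto_cdf_atBot η).eventually (gt_mem_nhds hu.1)).exists
    refine ⟨y, fun x hx => ?_⟩
    by_contra h
    exact absurd (hx.trans (monotone_cdf η (not_le.1 h).le)) (not_le.2 hy)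
  have hne : {x : ℝ | u ≤ cdf η x}.Nonempty := by
    obtain ⟨y, hy⟩ := ((tendsto_cdf_atTop η).eventually (lt_mem_nhds hu.2)).exists
    exact ⟨y, hy.le⟩
  refine ⟨fun h => ?_, fun h => csInf_le hb h⟩
  have hlt : ∀ y, x < y → u ≤ cdf η y := by
    intro y hy
    obtain ⟨z, hz, hzy⟩ := exists_lt_of_csInf_lt hne (lt_of_le_of_lt h hy)
    exact le_trans hz (monotone_cdf η hzy.le)
  have hc : Filter.Tendsto (cdf η) (nhdsWithin x (Ioi x)) (nhds (cdf η x)) :=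
    ((cdf η).right_continuous x).mono_left (nhdsWithin_mono x Ioi_subset_Ici_self)
  exact ge_of_tendsto hc (eventually_nhdsWithin_of_forall hlt)

theorem lt_quantile_iff (η : Measure ℝ) {u : ℝ} (hu : u ∈ Ioo (0 : ℝ) 1) (x : ℝ) :
    x < quantile η u ↔ cdf η x < u := by
  rw [← not_le, quantile_le_iff η hu, not_le]

theorem map_quantile (η : Measure ℝ) [IsProbabilityMeasure η] :
    unitLebesgue.map (quantile η) = η := by
  have : IsProbabilityMeasure (unitLebesgue.map (quantile η)) :=
    Measure.isProbabilityMeasure_map (measurable_quantile η).aemeasurable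
  refine Measure.ext_of_Iic _ _ fun x => ?_
  rw [Measure.map_apply (measurable_quantile η) measurableSet_Iic, ← ofReal_cdf η x,
    Measure.restrict_apply (measurable_quantile η measurableSet_Iic)]
  have h : (quantile η ⁻¹' Iic x ∩ Ioo 0 1 : Set ℝ) =ᵐ[volume] (Ioc 0 (cdf η x) : Set ℝ) := by
    -- The two sets can differ only at `u = 1`, when `cdf η x = 1`.
    have h1 : ∀ᵐ u : ℝ, u ≠ 1 := by simp [ae_iff]
    filter_upwards [h1] with u hu
    refine propext (⟨fun h => ⟨h.2.1, (quantile_le_iff η h.2 x).1 h.1⟩, fun h => ?_⟩)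
    have hI : u ∈ Ioo (0 : ℝ) 1 := ⟨h.1, lt_of_le_of_ne (h.2.trans (cdf_le_one η x)) hu⟩
    exact ⟨(quantile_le_iff η hI x).2 h.2, hI⟩
  rw [measure_congr h, Real.volume_Ioc, sub_zero]

theorem integral_comp_quantile (η : Measure ℝ) [IsProbabilityMeasure η] {f : ℝ → ℝ}
    (hf : Measurable f) : ∫ u, f (quantile η u) ∂unitLebesgue = ∫ x, f x ∂η := by
  conv_rhs => rw [← map_quantile η]
  rw [integral_map (measurable_quantile η).aemeasurable hf.aestronglyMeasurable]

theorem integrable_comp_quantile (η : Measure ℝ) [IsProbabilityMeasure η] {f : ℝ → ℝ}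
    (hi : Integrable f η) :
    Integrable (fun u => f (quantile η u)) unitLebesgue := by
  rw [← map_quantile η] at hi
  exact hi.comp_measurable (measurable_quantile η)

theorem integrable_quantile {η : Measure ℝ} (h : FiniteFirstMoment η) :
    Integrable (quantile η) unitLebesgue :=
  have := h.1
  integrable_comp_quantile η h.2

/-! ### The lower bound for the Wasserstein distance -/

/-- Layer cake: the positive part of `g - f` is the length of `[f, g)`, and Tonelli exchanges the
integrals. -/
theorem lintegral_ofReal_sub {α : Type*} [MeasurableSpace α] (ρ : Measure α) [SFinite ρ]
    {f g : α → ℝ} (hf : Measurable f) (hg : Measurable g) :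
    ∫⁻ a, ENNReal.ofReal (g a - f a) ∂ρ = ∫⁻ t, ρ {a | f a ≤ t ∧ t < g a} := by
  have hs : MeasurableSet {p : α × ℝ | f p.1 ≤ p.2 ∧ p.2 < g p.1} :=
    (measurableSet_le (hf.comp measurable_fst) measurable_snd).inter
      (measurableSet_lt measurable_snd (hg.comp measurable_fst))
  refine Eq.trans ?_ (Measure.prod_apply_symm (μ := ρ) (ν := volume) hs)
  rw [Measure.prod_apply hs]
  refine lintegral_congr fun a => ?_
  rw [← Real.volume_Ico]
  rfl

/-- At level `t`, the `u` with `F_μ⁻¹(u) ≤ t < F_ν⁻¹(u)` form the interval `(F_ν(t), F_μ(t)]` up to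
the point `1`. -/
theorem lintegral_quantile_sub (μ ν : Measure ℝ) :
    ∫⁻ u, ENNReal.ofReal (quantile ν u - quantile μ u) ∂unitLebesgue
      = ∫⁻ t, ENNReal.ofReal (cdf μ t - cdf ν t) := by
  rw [lintegral_ofReal_sub _ (measurable_quantile μ) (measurable_quantile ν)]
  refine lintegral_congr fun t => ?_
  rw [← Real.volume_Ioc, Measure.restrict_apply]
  swap
  · exact (measurableSet_le (measurable_quantile μ) measurable_const).inter
      (measurableSet_lt measurable_const (measurable_quantile ν))
  refine measure_congr ?_
  have h1 : ∀ᵐ u : ℝ, u ≠ 1 := by simp [ae_iff]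
  filter_upwards [h1] with u hu
  refine propext ⟨fun h => ⟨(lt_quantile_iff ν h.2 t).1 h.1.2, (quantile_le_iff μ h.2 t).1 h.1.1⟩,
    fun h => ?_⟩
  have hI : u ∈ Ioo (0 : ℝ) 1 := ⟨lt_of_le_of_lt (cdf_nonneg ν t) h.1,
    lt_of_le_of_ne (h.2.trans (cdf_le_one μ t)) hu⟩
  exact ⟨⟨(quantile_le_iff μ hI t).2 h.2, (lt_quantile_iff ν hI t).2 h.1⟩, hI⟩

/-- For an arbitrary coupling, the mass crossing level `t` is at least the cdf difference, because
`{f ≤ t}` is covered by the crossing event and `{g ≤ t}`. -/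
theorem ofReal_cdf_sub_le {μ ν : Measure ℝ} [IsProbabilityMeasure μ] [IsProbabilityMeasure ν]
    {α : Type*} [MeasurableSpace α] {ρ : Measure α} {f g : α → ℝ} (hf : Measurable f)
    (hg : Measurable g) (hμ : ρ.map f = μ) (hν : ρ.map g = ν) (t : ℝ) :
    ENNReal.ofReal (cdf μ t - cdf ν t) ≤ ρ {a | f a ≤ t ∧ t < g a} := by
  rw [ENNReal.ofReal_sub _ (cdf_nonneg ν t), ofReal_cdf, ofReal_cdf, tsub_le_iff_right, ← hμ,
    ← hν, Measure.map_apply hf measurableSet_Iic, Measure.map_apply hg measurableSet_Iic]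
  refine (measure_mono fun a (ha : f a ≤ t) => ?_).trans (measure_union_le _ _)
  by_cases h : g a ≤ t
  · exact Or.inr h
  · exact Or.inl ⟨ha, not_le.1 h⟩

theorem ofReal_abs_eq (x : ℝ) :
    ENNReal.ofReal |x| = ENNReal.ofReal x + ENNReal.ofReal (-x) := by
  rcases le_total 0 x with h | h
  · rw [abs_of_nonneg h, ENNReal.ofReal_of_nonpos (neg_nonpos.2 h), add_zero]
  · rw [abs_of_nonpos h, ENNReal.ofReal_of_nonpos h, zero_add]

theorem lintegral_abs_quantile_sub_le_W₁ (μ ν : Measure ℝ) [IsProbabilityMeasure μ]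
    [IsProbabilityMeasure ν] :
    ∫⁻ u, ENNReal.ofReal |quantile μ u - quantile ν u| ∂unitLebesgue ≤ W₁ μ ν := by
  refine le_iInf₂ fun P hP => ?_
  have : IsProbabilityMeasure P := by
    have h : IsProbabilityMeasure (P.map Prod.fst) := hP.1 ▸ inferInstance
    exact Measure.isProbabilityMeasure_of_map Prod.fst
  have hμ := measurable_quantile μ
  have hν := measurable_quantile ν
  simp_rw [cost, ofReal_abs_eq, neg_sub]
  rw [lintegral_add_left (by fun_prop), lintegral_add_left (by fun_prop),
    lintegral_quantile_sub, lintegral_quantile_sub, lintegral_ofReal_sub _ measurable_snd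
    measurable_fst, lintegral_ofReal_sub _ measurable_fst measurable_snd]
  exact add_le_add
    (lintegral_mono fun t => ofReal_cdf_sub_le measurable_snd measurable_fst hP.2 hP.1 t)
    (lintegral_mono fun t => ofReal_cdf_sub_le measurable_fst measurable_snd hP.1 hP.2 t)

/-! ### Consequences of the convex order -/

theorem lintegral_ofReal_sub_lt_top {α : Type*} [MeasurableSpace α] {ρ : Measure α} {f g : α → ℝ}
    (hf : Integrable f ρ) (hg : Integrable g ρ) :
    ∫⁻ a, ENNReal.ofReal (f a - g a) ∂ρ < ∞ :=
  (hf.sub hg).lintegral_lt_top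

theorem gam_ne_top {μ ν : Measure ℝ} (hμ : FiniteFirstMoment μ) (hν : FiniteFirstMoment ν) :
    gam μ ν ≠ ∞ :=
  (lintegral_ofReal_sub_lt_top (integrable_quantile hμ) (integrable_quantile hν)).ne

/-- Both `x` and `-x` are convex, so the means agree. -/
theorem integral_quantile_eq {μ ν : Measure ℝ} (hμ : FiniteFirstMoment μ)
    (hν : FiniteFirstMoment ν) (h : ConvexOrder μ ν) :
    ∫ u, quantile μ u ∂unitLebesgue = ∫ u, quantile ν u ∂unitLebesgue := by
  have := hμ.1
  have := hν.1
  rw [integral_comp_quantile μ (f := fun x => x) measurable_id,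
    integral_comp_quantile ν (f := fun x => x) measurable_id]
  have h1 := (h (fun x => x) (convexOn_id convex_univ) hν.2).2
  have h2 := (h (fun x => -x) (concaveOn_id convex_univ).neg hν.2.neg).2
  rw [integral_neg, integral_neg] at h2
  linarith

theorem setIntegral_quantile_le {μ ν : Measure ℝ} (hμ : FiniteFirstMoment μ)
    (hν : FiniteFirstMoment ν) (h : ConvexOrder μ ν) {u : ℝ} (hu : u ∈ Ioo (0 : ℝ) 1) :
    ∫ t in Iic u, quantile ν t ∂unitLebesgue ≤ ∫ t in Iic u, quantile μ t ∂unitLebesgue := by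
  have := hμ.1
  have := hν.1
  -- Test the convex order on `(c - x)⁺`. With this `c`, the positive part along `F_ν⁻¹` is cut off
  -- exactly at `u`, whereas along `F_μ⁻¹` restricting to `t ≤ u` can only lower the integral.
  set c := quantile ν u
  have hm : Measurable fun x : ℝ => max (c - x) 0 := by fun_prop
  have hcv : ConvexOn ℝ univ fun x : ℝ => max (c - x) 0 := by
    refine ConvexOn.sup ?_ (convexOn_const 0 convex_univ)
    exact (convexOn_const c convex_univ).sub (concaveOn_id convex_univ)
  have hi : ∀ {η : Measure ℝ}, FiniteFirstMoment η → Integrable (fun x : ℝ => max (c - x) 0) η :=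
    fun {η} hη => by
      have := hη.1
      exact ((integrable_const c).sub hη.2).pos_part
  have key := (h _ hcv (hi hν)).2
  rw [← integral_comp_quantile μ hm, ← integral_comp_quantile ν hm] at key
  have hνi := integrable_quantile hν
  have hμi := integrable_quantile hμ
  have e1 : ∫ t, max (c - quantile ν t) 0 ∂unitLebesgue
      = ∫ t in Iic u, (c - quantile ν t) ∂unitLebesgue := by
    rw [← integral_indicator measurableSet_Iic]
    refine integral_congr_ae ?_
    filter_upwards [ae_restrict_mem measurableSet_Ioo] with t ht
    by_cases htu : t ≤ u
    · rw [indicator_of_mem (show t ∈ Iic u from htu)]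
      exact max_eq_left (sub_nonneg.2 (quantile_monotoneOn ν ht hu htu))
    · rw [indicator_of_notMem (show t ∉ Iic u from htu)]
      exact max_eq_right (sub_nonpos.2 (quantile_monotoneOn ν hu ht (not_le.1 htu).le))
  have e2 : ∫ t in Iic u, (c - quantile μ t) ∂unitLebesgue
      ≤ ∫ t, max (c - quantile μ t) 0 ∂unitLebesgue := by
    refine le_trans (integral_mono ((integrable_const c).sub hμi.integrableOn)
      (integrable_comp_quantile μ (hi hμ)).integrableOn fun t => le_max_left _ _) ?_
    exact setIntegral_le_integral (integrable_comp_quantile μ (hi hμ))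
      (Filter.Eventually.of_forall fun t => le_max_right _ _)
  rw [e1] at key
  have e3 := e2.trans key
  rw [integral_sub (integrable_const c) hμi.integrableOn,
    integral_sub (integrable_const c) hνi.integrableOn] at e3
  linarith

theorem ofReal_integral_sub_add {α : Type*} [MeasurableSpace α] {ρ : Measure α} {f g : α → ℝ}
    (hf : Integrable f ρ) (hg : Integrable g ρ) :
    ∫ a, f a ∂ρ - ∫ a, g a ∂ρ = (∫⁻ a, ENNReal.ofReal (f a - g a) ∂ρ).toReal
      - (∫⁻ a, ENNReal.ofReal (g a - f a) ∂ρ).toReal := by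
  rw [← integral_sub hf hg, integral_eq_lintegral_pos_part_sub_lintegral_neg_part
    (f := fun a => f a - g a) (hf.sub hg)]
  simp only [neg_sub]

/-- Equal means balance the positive and negative parts, so the one constant `γ` normalises both
marginals. -/
theorem lintegral_minus_eq_gam {μ ν : Measure ℝ} (hμ : FiniteFirstMoment μ)
    (hν : FiniteFirstMoment ν) (h : ConvexOrder μ ν) :
    ∫⁻ u, ENNReal.ofReal (quantile ν u - quantile μ u) ∂unitLebesgue = gam μ ν := by
  have h1 := ofReal_integral_sub_add (integrable_quantile hμ) (integrable_quantile hν)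
  rw [integral_quantile_eq hμ hν h, sub_self, eq_comm, sub_eq_zero] at h1
  exact ((ENNReal.toReal_eq_toReal_iff' (gam_ne_top hμ hν)
    (lintegral_ofReal_sub_lt_top (integrable_quantile hν) (integrable_quantile hμ)).ne).1 h1).symm

theorem setLIntegral_minus_le_plus {μ ν : Measure ℝ} (hμ : FiniteFirstMoment μ)
    (hν : FiniteFirstMoment ν) (h : ConvexOrder μ ν) (u : ℝ) :
    ∫⁻ t in Iic u, ENNReal.ofReal (quantile ν t - quantile μ t) ∂unitLebesgue
      ≤ ∫⁻ t in Iic u, ENNReal.ofReal (quantile μ t - quantile ν t) ∂unitLebesgue := by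
  rcases le_or_gt u 0 with h0 | h0
  · have : unitLebesgue (Iic u) = 0 := by
      rw [Measure.restrict_apply measurableSet_Iic]
      convert measure_empty (μ := (volume : Measure ℝ))
      ext t
      simp only [mem_inter_iff, mem_Iic, mem_Ioo, mem_empty_iff_false]
      constructor
      · rintro ⟨_, _, _⟩
        linarith
      · exact False.elim
    simp [Measure.restrict_eq_zero.2 this]
  rcases lt_or_ge u 1 with h1 | h1
  · have hνi := (integrable_quantile hν).integrableOn (s := Iic u)
    have hμi := (integrable_quantile hμ).integrableOn (s := Iic u)
    have e := ofReal_integral_sub_add hμi hνi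
    have e2 := setIntegral_quantile_le hμ hν h ⟨h0, h1⟩
    rw [← ENNReal.toReal_le_toReal (lintegral_ofReal_sub_lt_top hνi hμi).ne
      (lintegral_ofReal_sub_lt_top hμi hνi).ne]
    linarith
  · have : unitLebesgue.restrict (Iic u) = unitLebesgue := by
      rw [Measure.restrict_restrict measurableSet_Iic, inter_eq_right.2]
      exact fun t ht => ht.2.le.trans h1
    rw [this]
    exact (lintegral_minus_eq_gam hμ hν h).le

/-- If `γ = 0`, both parts of the quantile difference vanish almost everywhere, which forces `μ =
ν`. -/
theorem gam_ne_zero {μ ν : Measure ℝ} (hμ : FiniteFirstMoment μ)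
    (hν : FiniteFirstMoment ν) (h : StrictConvexOrder μ ν) : gam μ ν ≠ 0 := by
  intro h0
  have := hμ.1
  have := hν.1
  refine h.2 ?_
  have hm := measurable_quantile μ
  have hn := measurable_quantile ν
  have h1 := lintegral_minus_eq_gam hμ hν h.1
  rw [h0, lintegral_eq_zero_iff (by fun_prop)] at h1
  have h2 := h0
  rw [gam, lintegral_eq_zero_iff (by fun_prop)] at h2
  rw [← map_quantile μ, ← map_quantile ν]
  refine Measure.map_congr ?_
  filter_upwards [h1, h2] with u hu1 hu2
  simp only [Pi.zero_apply, ENNReal.ofReal_eq_zero] at hu1 hu2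
  linarith

/-! ### The set of admissible couplings is nonempty -/

theorem measurable_plusDensity (μ ν : Measure ℝ) :
    Measurable fun u => ENNReal.ofReal (quantile μ u - quantile ν u) / gam μ ν := by
  have := measurable_quantile μ
  have := measurable_quantile ν
  fun_prop

theorem measurable_minusDensity (μ ν : Measure ℝ) :
    Measurable fun u => ENNReal.ofReal (quantile ν u - quantile μ u) / gam μ ν := by
  have := measurable_quantile μ
  have := measurable_quantile ν
  fun_prop

theorem measurableSet_Uplus (μ ν : Measure ℝ) : MeasurableSet (Uplus μ ν) :=
  measurableSet_Ioo.inter (measurableSet_lt (measurable_quantile ν) (measurable_quantile μ))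

theorem measurableSet_Uminus (μ ν : Measure ℝ) : MeasurableSet (Uminus μ ν) :=
  measurableSet_Ioo.inter (measurableSet_lt (measurable_quantile μ) (measurable_quantile ν))

theorem plusMarginal_apply (μ ν : Measure ℝ) {s : Set ℝ} (hs : MeasurableSet s) :
    plusMarginal μ ν s
      = (∫⁻ u in s, ENNReal.ofReal (quantile μ u - quantile ν u) ∂unitLebesgue) / gam μ ν := by
  have := measurable_quantile μ
  have := measurable_quantile ν
  simp_rw [plusMarginal, withDensity_apply _ hs, div_eq_mul_inv]
  rw [lintegral_mul_const _ (by fun_prop)]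

theorem minusMarginal_apply (μ ν : Measure ℝ) {s : Set ℝ} (hs : MeasurableSet s) :
    minusMarginal μ ν s
      = (∫⁻ u in s, ENNReal.ofReal (quantile ν u - quantile μ u) ∂unitLebesgue) / gam μ ν := by
  have := measurable_quantile μ
  have := measurable_quantile ν
  simp_rw [minusMarginal, withDensity_apply _ hs, div_eq_mul_inv]
  rw [lintegral_mul_const _ (by fun_prop)]

theorem isProbabilityMeasure_plusMarginal {μ ν : Measure ℝ} (hμ : FiniteFirstMoment μ)
    (hν : FiniteFirstMoment ν) (h : StrictConvexOrder μ ν) :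
    IsProbabilityMeasure (plusMarginal μ ν) := by
  refine ⟨?_⟩
  rw [plusMarginal_apply μ ν MeasurableSet.univ, Measure.restrict_univ]
  exact ENNReal.div_self (gam_ne_zero hμ hν h) (gam_ne_top hμ hν)

theorem isProbabilityMeasure_minusMarginal {μ ν : Measure ℝ} (hμ : FiniteFirstMoment μ)
    (hν : FiniteFirstMoment ν) (h : StrictConvexOrder μ ν) :
    IsProbabilityMeasure (minusMarginal μ ν) := by
  refine ⟨?_⟩
  rw [minusMarginal_apply μ ν MeasurableSet.univ, Measure.restrict_univ,
    lintegral_minus_eq_gam hμ hν h.1]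
  exact ENNReal.div_self (gam_ne_zero hμ hν h) (gam_ne_top hμ hν)

/-- Within `(0, 1)` the density is nonzero exactly on `𝒰₊`; finiteness of `γ` prevents the division
from killing it. -/
theorem ae_plusMarginal_iff {μ ν : Measure ℝ} (hγ : gam μ ν ≠ ∞) {p : ℝ → Prop} :
    (∀ᵐ u ∂plusMarginal μ ν, p u) ↔ ∀ᵐ u ∂volume.restrict (Uplus μ ν), p u := by
  rw [plusMarginal, ae_withDensity_iff (measurable_plusDensity μ ν),
    ae_restrict_iff' measurableSet_Ioo, ae_restrict_iff' (measurableSet_Uplus μ ν)]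
  refine Filter.eventually_congr (Filter.Eventually.of_forall fun u => ?_)
  simp only [Uplus, mem_ofPred_eq, and_imp, ne_eq, ENNReal.div_eq_zero_iff, hγ, or_false,
    ENNReal.ofReal_eq_zero, not_le, sub_pos]

theorem ae_minusMarginal_iff {μ ν : Measure ℝ} (hγ : gam μ ν ≠ ∞) {p : ℝ → Prop} :
    (∀ᵐ u ∂minusMarginal μ ν, p u) ↔ ∀ᵐ u ∂volume.restrict (Uminus μ ν), p u := by
  rw [minusMarginal, ae_withDensity_iff (measurable_minusDensity μ ν),
    ae_restrict_iff' measurableSet_Ioo, ae_restrict_iff' (measurableSet_Uminus μ ν)]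
  refine Filter.eventually_congr (Filter.Eventually.of_forall fun u => ?_)
  simp only [Uminus, mem_ofPred_eq, and_imp, ne_eq, ENNReal.div_eq_zero_iff, hγ, or_false,
    ENNReal.ofReal_eq_zero, not_le, sub_pos]

theorem ae_mem_Uplus {μ ν : Measure ℝ} (hγ : gam μ ν ≠ ∞) :
    ∀ᵐ u ∂plusMarginal μ ν, u ∈ Uplus μ ν :=
  (ae_plusMarginal_iff hγ).2 (ae_restrict_mem (measurableSet_Uplus μ ν))

theorem ae_mem_Uminus {μ ν : Measure ℝ} (hγ : gam μ ν ≠ ∞) :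
    ∀ᵐ u ∂minusMarginal μ ν, u ∈ Uminus μ ν :=
  (ae_minusMarginal_iff hγ).2 (ae_restrict_mem (measurableSet_Uminus μ ν))

theorem cdf_minusMarginal_le {μ ν : Measure ℝ} (hμ : FiniteFirstMoment μ)
    (hν : FiniteFirstMoment ν) (h : StrictConvexOrder μ ν) (x : ℝ) :
    cdf (minusMarginal μ ν) x ≤ cdf (plusMarginal μ ν) x := by
  have := isProbabilityMeasure_plusMarginal hμ hν h
  have := isProbabilityMeasure_minusMarginal hμ hν h
  rw [cdf_eq_real, cdf_eq_real]
  refine ENNReal.toReal_mono (measure_ne_top _ _) ?_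
  rw [plusMarginal_apply μ ν measurableSet_Iic, minusMarginal_apply μ ν measurableSet_Iic]
  exact ENNReal.div_le_div_right (setLIntegral_minus_le_plus hμ hν h.1 x) _

theorem quantile_le_quantile {η θ : Measure ℝ} (h : ∀ x, cdf θ x ≤ cdf η x) {u : ℝ}
    (hu : u ∈ Ioo (0 : ℝ) 1) : quantile η u ≤ quantile θ u :=
  (quantile_le_iff η hu _).2 (((quantile_le_iff θ hu _).1 le_rfl).trans (h _))

theorem calQ_nonempty {μ ν : Measure ℝ} (hμ : FiniteFirstMoment μ)
    (hν : FiniteFirstMoment ν) (h : StrictConvexOrder μ ν) : (calQ μ ν).Nonempty := by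
  have := isProbabilityMeasure_plusMarginal hμ hν h
  have := isProbabilityMeasure_minusMarginal hμ hν h
  have hp := measurable_quantile (plusMarginal μ ν)
  have hm := measurable_quantile (minusMarginal μ ν)
  have hpm := hp.prodMk hm
  refine ⟨unitLebesgue.map fun t => (quantile (plusMarginal μ ν) t, quantile (minusMarginal μ ν) t),
    Measure.isProbabilityMeasure_map hpm.aemeasurable, ?_, ?_, ?_⟩
  · rw [Measure.map_map measurable_fst hpm]
    exact map_quantile _
  · rw [Measure.map_map measurable_snd hpm]
    exact map_quantile _
  · have hs : MeasurableSet {p : ℝ × ℝ | p.1 < p.2} :=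
      measurableSet_lt measurable_fst measurable_snd
    rw [Measure.map_apply hpm hs, ← mem_ae_iff_prob_eq_one (hpm hs)]
    have h1 := ae_mem_Uplus (gam_ne_top hμ hν)
    have h2 := ae_mem_Uminus (gam_ne_top hμ hν)
    rw [← map_quantile (plusMarginal μ ν)] at h1
    rw [← map_quantile (minusMarginal μ ν)] at h2
    filter_upwards [ae_of_ae_map hp.aemeasurable h1, ae_of_ae_map hm.aemeasurable h2,
      ae_restrict_mem measurableSet_Ioo] with t ht1 ht2 ht
    -- Dominance gives only `≤`; equality would put one point in both `𝒰₊` and `𝒰₋`.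
    refine lt_of_le_of_ne (quantile_le_quantile (cdf_minusMarginal_le hμ hν h) ht) fun he => ?_
    rw [← he] at ht2
    exact lt_asymm ht1.2 ht2.2

/-! ### Existence of the disintegrations -/

/-- Restricting the conditional kernel to `s` makes it vanish off `s` everywhere, at the price of
being only sub-Markov on a null set. -/
theorem exists_kernel_of_ae_snd_mem (Q : Measure (ℝ × ℝ)) [IsProbabilityMeasure Q] {s : Set ℝ}
    (hs : MeasurableSet s) (h : ∀ᵐ v ∂Q.map Prod.snd, v ∈ s) :
    ∃ κ : Kernel ℝ ℝ, (∀ u, κ u univ ≤ 1) ∧ (∀ u, κ u sᶜ = 0) ∧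
      (∀ᵐ u ∂Q.map Prod.fst, κ u s = 1) ∧ Q = Q.map Prod.fst ⊗ₘ κ := by
  have hQ : Q.map Prod.fst ⊗ₘ Q.condKernel = Q := Q.disintegrate Q.condKernel
  have hfst : IsProbabilityMeasure (Q.map Prod.fst) :=
    Measure.isProbabilityMeasure_map measurable_fst.aemeasurable
  have hae : ∀ᵐ u ∂Q.map Prod.fst, ∀ᵐ v ∂Q.condKernel u, v ∈ s := by
    have h1 := ae_of_ae_map measurable_snd.aemeasurable h
    rw [← hQ] at h1
    exact Measure.ae_ae_of_ae_compProd h1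
  refine ⟨Q.condKernel.restrict hs, fun u => ?_, fun u => ?_, ?_, ?_⟩
  · rw [Kernel.restrict_apply, Measure.restrict_apply_univ]
    exact prob_le_one
  · rw [Kernel.restrict_apply, Measure.restrict_apply hs.compl, compl_inter_self, measure_empty]
  · filter_upwards [hae] with u hu
    rw [Kernel.restrict_apply, Measure.restrict_apply_self]
    exact (mem_ae_iff_prob_eq_one hs).1 hu
  · conv_lhs => rw [← hQ]
    refine Measure.compProd_congr ?_
    filter_upwards [hae] with u hu
    rw [Kernel.restrict_apply, Measure.restrict_eq_self_of_ae_mem hu]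

theorem nonempty_disintegration {μ ν : Measure ℝ} {Q : Measure (ℝ × ℝ)} (hγ : gam μ ν ≠ ∞)
    (hQ : Q ∈ calQ μ ν) : Nonempty (Disintegration μ ν Q) := by
  obtain ⟨hprob, hfst, hsnd, -⟩ := hQ
  have hswap : IsProbabilityMeasure (Q.map Prod.swap) :=
    Measure.isProbabilityMeasure_map measurable_swap.aemeasurable
  have hfst' : (Q.map Prod.swap).map Prod.fst = minusMarginal μ ν := by
    rw [Measure.map_map measurable_fst measurable_swap, ← hsnd]
    rfl
  have hsnd' : (Q.map Prod.swap).map Prod.snd = plusMarginal μ ν := by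
    rw [Measure.map_map measurable_snd measurable_swap, ← hfst]
    rfl
  obtain ⟨κ, h1, h2, h3, h4⟩ := exists_kernel_of_ae_snd_mem Q (measurableSet_Ioo (a := (0 : ℝ))
    (b := 1)) (by rw [hsnd]; exact (ae_mem_Uminus hγ).mono fun v hv => hv.1)
  obtain ⟨κ', h1', h2', h3', h4'⟩ := exists_kernel_of_ae_snd_mem (Q.map Prod.swap)
    (measurableSet_Ioo (a := (0 : ℝ)) (b := 1))
    (by rw [hsnd']; exact (ae_mem_Uplus hγ).mono fun v hv => hv.1)
  rw [hfst] at h3 h4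
  rw [hfst'] at h3' h4'
  refine ⟨⟨κ, κ', h1, h1', h2, h2', (ae_plusMarginal_iff hγ).1 h3, (ae_minusMarginal_iff hγ).1 h3',
    h4, ?_⟩⟩
  rw [← h4', Measure.map_map measurable_swap measurable_swap]
  simp

/-! ### The kernel on the line in terms of the uniform variable -/

theorem leftLim_cdf_nonneg (μ : Measure ℝ) (x : ℝ) : 0 ≤ Function.leftLim (cdf μ) x :=
  (cdf_nonneg μ (x - 1)).trans ((monotone_cdf μ).le_leftLim (sub_one_lt x))

theorem leftLim_cdf_quantile_le (μ : Measure ℝ) {u : ℝ} (hu : u ∈ Ioo (0 : ℝ) 1) :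
    Function.leftLim (cdf μ) (quantile μ u) ≤ u :=
  le_of_tendsto ((monotone_cdf μ).tendsto_leftLim _)
    (eventually_nhdsWithin_of_forall fun y hy => ((lt_quantile_iff μ hu y).1 hy).le)

theorem le_cdf_quantile (μ : Measure ℝ) {u : ℝ} (hu : u ∈ Ioo (0 : ℝ) 1) :
    u ≤ cdf μ (quantile μ u) :=
  (quantile_le_iff μ hu _).1 le_rfl

/-- The quantile function is flat precisely over the jumps of the cdf, up to endpoints. -/
theorem quantile_preimage_singleton_ae_eq (μ : Measure ℝ) (x : ℝ) :
    (quantile μ ⁻¹' {x} ∩ Ioo 0 1 : Set ℝ)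
      =ᵐ[volume] (Ioc (Function.leftLim (cdf μ) x) (cdf μ x) : Set ℝ) := by
  have h1 : ∀ᵐ u : ℝ, u ≠ 1 := by simp [ae_iff]
  have h2 : ∀ᵐ u : ℝ, u ≠ Function.leftLim (cdf μ) x := by simp [ae_iff]
  filter_upwards [h1, h2] with u hu1 hu2
  refine propext ⟨?_, fun h => ?_⟩
  · rintro ⟨rfl, hI⟩
    exact ⟨lt_of_le_of_ne (leftLim_cdf_quantile_le μ hI) hu2.symm, le_cdf_quantile μ hI⟩
  · have hI : u ∈ Ioo (0 : ℝ) 1 := ⟨lt_of_le_of_lt (leftLim_cdf_nonneg μ x) h.1,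
      lt_of_le_of_ne (h.2.trans (cdf_le_one μ x)) hu1⟩
    refine ⟨le_antisymm ((quantile_le_iff μ hI x).2 h.2) (not_lt.1 fun hlt => ?_), hI⟩
    exact absurd ((le_cdf_quantile μ hI).trans ((monotone_cdf μ).le_leftLim hlt)) (not_le.2 h.1)

theorem restrict_quantile_preimage_singleton (μ : Measure ℝ) (x : ℝ) :
    unitLebesgue.restrict (quantile μ ⁻¹' {x})
      = volume.restrict (Ioc (Function.leftLim (cdf μ) x) (cdf μ x)) := by
  rw [Measure.restrict_restrict (measurable_quantile μ (measurableSet_singleton x))]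
  exact Measure.restrict_congr_set (quantile_preimage_singleton_ae_eq μ x)

theorem lineKernel_of_atom (μ : Measure ℝ) [IsProbabilityMeasure μ] (k : Kernel ℝ ℝ)
    [IsMarkovKernel k] {x : ℝ} (hx : Function.leftLim (cdf μ) x ≠ cdf μ x) :
    lineKernel μ k x = (μ {x})⁻¹ •
      (volume.restrict (Ioc (Function.leftLim (cdf μ) x) (cdf μ x))).bind k := by
  have hlt : Function.leftLim (cdf μ) x < cdf μ x :=
    lt_of_le_of_ne ((monotone_cdf μ).leftLim_le le_rfl) hx
  have h0 := leftLim_cdf_nonneg μ x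
  have h1 := cdf_le_one μ x
  refine (if_neg ?_).trans (if_pos ?_)
  · rintro (h | h) <;> linarith
  · rw [← cdf_sub_leftLim]
    exact ENNReal.ofReal_pos.2 (sub_pos.2 hlt)

theorem lineKernel_quantile_of_not_atom (μ : Measure ℝ) [IsProbabilityMeasure μ] (k : Kernel ℝ ℝ)
    [IsMarkovKernel k] {u : ℝ} (hu : u ∈ Ioo (0 : ℝ) 1)
    (hx : Function.leftLim (cdf μ) (quantile μ u) = cdf μ (quantile μ u)) :
    lineKernel μ k (quantile μ u) = k u := by
  have h1 : cdf μ (quantile μ u) = u :=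
    le_antisymm (hx ▸ leftLim_cdf_quantile_le μ hu) (le_cdf_quantile μ hu)
  refine (if_neg ?_).trans ((if_neg ?_).trans (by rw [h1]))
  · rw [hx, h1]
    rintro (h | h)
    · exact hu.1.ne' h
    · exact hu.2.ne h
  · rw [← cdf_sub_leftLim, hx, sub_self, ENNReal.ofReal_zero]
    exact lt_irrefl 0

/-- Over the countably many jumps the line kernel is an average of `k`, which preserves the
integral; elsewhere `F_μ(F_μ⁻¹(u)) = u` and the integrands coincide. -/
theorem setLIntegral_lineKernel_quantile (μ : Measure ℝ) [IsProbabilityMeasure μ] (k : Kernel ℝ ℝ)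
    [IsMarkovKernel k] {s t : Set ℝ} (hs : MeasurableSet s) (ht : MeasurableSet t) :
    ∫⁻ u in quantile μ ⁻¹' s, lineKernel μ k (quantile μ u) t ∂unitLebesgue
      = ∫⁻ u in quantile μ ⁻¹' s, k u t ∂unitLebesgue := by
  set A := {x | Function.leftLim (cdf μ) x ≠ cdf μ x}
  have hA : A.Countable := StieltjesFunction.countable_leftLim_ne (cdf μ)
  have hq := measurable_quantile μ
  have hAm : MeasurableSet (quantile μ ⁻¹' A) := hq hA.measurableSet
  rw [← lintegral_inter_add_sdiff _ _ hAm, ← lintegral_inter_add_sdiff (fun u => k u t) _ hAm]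
  congr 1
  · have hU : quantile μ ⁻¹' s ∩ quantile μ ⁻¹' A = ⋃ x ∈ s ∩ A, quantile μ ⁻¹' {x} := by
      rw [← preimage_inter, ← biUnion_preimage_singleton]
    have hc : (s ∩ A).Countable := hA.mono inter_subset_right
    have hm : ∀ x ∈ s ∩ A, MeasurableSet (quantile μ ⁻¹' {x}) :=
      fun x _ => hq (measurableSet_singleton x)
    have hd : (s ∩ A).PairwiseDisjoint fun x => quantile μ ⁻¹' {x} :=
      fun x _ y _ hxy => (disjoint_singleton.2 hxy).preimage _
    rw [hU, lintegral_biUnion hc hm hd, lintegral_biUnion hc hm hd]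
    refine tsum_congr fun ⟨x, hx⟩ => ?_
    have hpos : μ {x} ≠ 0 := by
      rw [← cdf_sub_leftLim]
      exact (ENNReal.ofReal_pos.2 (sub_pos.2
        (lt_of_le_of_ne ((monotone_cdf μ).leftLim_le le_rfl) hx.2))).ne'
    -- The integrand is constant on this interval, whose length `μ {x}` cancels the normalising
    -- factor.
    have hconst : ∫⁻ u in quantile μ ⁻¹' {x}, lineKernel μ k (quantile μ u) t ∂unitLebesgue
        = ∫⁻ _ in quantile μ ⁻¹' {x}, lineKernel μ k x t ∂unitLebesgue :=
      setLIntegral_congr_fun (hq (measurableSet_singleton x))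
        fun u (hu : quantile μ u = x) => by simp only [hu]
    rw [hconst, lintegral_const, restrict_quantile_preimage_singleton,
      Measure.restrict_apply_univ, Real.volume_Ioc, cdf_sub_leftLim,
      lineKernel_of_atom μ k hx.2, Measure.smul_apply, smul_eq_mul,
      Measure.bind_apply ht k.measurable.aemeasurable, mul_right_comm,
      ENNReal.inv_mul_cancel hpos (measure_ne_top _ _), one_mul]
  · refine setLIntegral_congr_fun_ae ((hq hs).diff hAm) ?_
    filter_upwards [ae_restrict_mem measurableSet_Ioo] with u hu hus
    rw [lineKernel_quantile_of_not_atom μ k hu (not_not.1 hus.2)]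

theorem compProd_lineKernel (μ : Measure ℝ) [IsProbabilityMeasure μ] (k : Kernel ℝ ℝ)
    [IsMarkovKernel k] :
    μ ⊗ₘ lineKernel μ k = (unitLebesgue ⊗ₘ k).map (Prod.map (quantile μ) id) := by
  have hq := measurable_quantile μ
  refine Measure.ext_prod fun {s t} hs ht => ?_
  rw [Measure.map_apply (hq.prodMap measurable_id) (hs.prod ht), preimage_prod_map_prod,
    preimage_id, Measure.compProd_apply_prod hs ht, Measure.compProd_apply_prod (hq hs) ht,
    ← setLIntegral_lineKernel_quantile μ k hs ht]
  have h := setLIntegral_map (μ := unitLebesgue) hs ((lineKernel μ k).measurable_coe ht) hq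
  rwa [map_quantile] at h

theorem lintegral_compProd_lineKernel (μ : Measure ℝ) [IsProbabilityMeasure μ] (k : Kernel ℝ ℝ)
    [IsMarkovKernel k] {f : ℝ × ℝ → ℝ≥0∞} (hf : Measurable f) :
    ∫⁻ p, f p ∂(μ ⊗ₘ lineKernel μ k) = ∫⁻ u, ∫⁻ y, f (quantile μ u, y) ∂(k u) ∂unitLebesgue := by
  have hq := (measurable_quantile μ).prodMap (measurable_id (α := ℝ))
  rw [compProd_lineKernel, lintegral_map hf hq]
  exact Measure.lintegral_compProd (hf.comp hq)

theorem snd_compProd_lineKernel (μ : Measure ℝ) [IsProbabilityMeasure μ] (k : Kernel ℝ ℝ)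
    [IsMarkovKernel k] : (μ ⊗ₘ lineKernel μ k).map Prod.snd = unitLebesgue.bind k := by
  rw [compProd_lineKernel, Measure.map_map measurable_snd
    ((measurable_quantile μ).prodMap measurable_id)]
  exact Measure.snd_compProd _ _

/-- The barycentre of `lineKernel μ k x` and `x` itself have equal integrals over every measurable
set, as seen by pulling back to `(0, 1)`; so they agree almost everywhere. -/
theorem ae_integral_lineKernel (μ : Measure ℝ) (hμ : Integrable (fun x : ℝ => x) μ)
    [IsProbabilityMeasure μ] (k : Kernel ℝ ℝ) [IsMarkovKernel k]
    (hk : Integrable (fun y : ℝ => y) (unitLebesgue.bind k))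
    (hmean : ∀ᵐ u ∂unitLebesgue, ∫ y, y ∂(k u) = quantile μ u) :
    ∀ᵐ x ∂μ, Integrable (fun y : ℝ => y) (lineKernel μ k x) ∧
      ∫ y, y ∂(lineKernel μ k x) = x := by
  have hq := measurable_quantile μ
  have hΦ : Measurable (Prod.map (quantile μ) (id : ℝ → ℝ)) := hq.prodMap measurable_id
  have hi : Integrable (fun p : ℝ × ℝ => p.2) (μ ⊗ₘ lineKernel μ k) := by
    rw [← snd_compProd_lineKernel μ k] at hk
    exact hk.comp_measurable measurable_snd
  have hi' : Integrable (fun p : ℝ × ℝ => p.2) (unitLebesgue ⊗ₘ k) :=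
    (Measure.snd_compProd unitLebesgue k ▸ hk).comp_measurable measurable_snd
  have h1 := ((Measure.integrable_compProd_iff hi.aestronglyMeasurable).1 hi).1
  have h2 : (fun x => ∫ y, y ∂(lineKernel μ k x)) =ᵐ[μ] fun x => x := by
    refine Integrable.ae_eq_of_forall_setIntegral_eq _ _ ?_ hμ fun s hs _ => ?_
    · have h := Integrable.integral_compProd (κ := Kernel.const Unit μ)
        (η := Kernel.prodMkLeft Unit (lineKernel μ k)) (a := ()) hi
      simpa only [Kernel.const_apply, Kernel.prodMkLeft_apply] using h
    have e1 := Measure.setIntegral_compProd hs MeasurableSet.univ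
      (hi.integrableOn (s := s ×ˢ univ))
    have e2 := Measure.setIntegral_compProd (hq hs) MeasurableSet.univ
      (hi'.integrableOn (s := (quantile μ ⁻¹' s) ×ˢ univ))
    simp only [Measure.restrict_univ] at e1 e2
    rw [← e1, compProd_lineKernel, setIntegral_map (hs.prod MeasurableSet.univ)
      measurable_snd.aestronglyMeasurable hΦ.aemeasurable, preimage_prod_map_prod, preimage_univ]
    refine e2.trans ?_
    rw [integral_congr_ae (ae_restrict_of_ae hmean)]
    conv_rhs => rw [← map_quantile μ]
    exact (setIntegral_map (f := fun x : ℝ => x) hs measurable_id.aestronglyMeasurable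
      hq.aemeasurable).symm
  filter_upwards [h1, h2] with x hx1 hx2 using ⟨hx1, hx2⟩

/-! ### The kernel on the uniform variable -/

theorem measurable_splitWeight (μ ν : Measure ℝ) (u : ℝ) : Measurable fun v => ENNReal.ofReal
    ((quantile μ u - quantile ν u) / (quantile ν v - quantile ν u)) := by
  have := measurable_quantile ν
  fun_prop

theorem lintegral_splitMeasure (μ ν ρ : Measure ℝ) (u : ℝ) {f : ℝ → ℝ≥0∞} (hf : Measurable f) :
    ∫⁻ y, f y ∂splitMeasure μ ν ρ u = ∫⁻ v, (ENNReal.ofReal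
      ((quantile μ u - quantile ν u) / (quantile ν v - quantile ν u)) * f (quantile ν v)
      + ENNReal.ofReal ((quantile ν v - quantile μ u) / (quantile ν v - quantile ν u))
        * f (quantile ν u)) ∂ρ := by
  have hν := measurable_quantile ν
  have hw := measurable_splitWeight μ ν u
  have hm : Measurable fun v => ENNReal.ofReal ((quantile μ u - quantile ν u) /
      (quantile ν v - quantile ν u)) * f (quantile ν v) := hw.mul (hf.comp hν)
  rw [splitMeasure, lintegral_add_measure, lintegral_smul_measure, lintegral_dirac' _ hf,
    lintegral_map hf hν, lintegral_add_left hm,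
    lintegral_mul_const _ (by fun_prop), smul_eq_mul]
  congr 1
  exact lintegral_withDensity_eq_lintegral_mul _ hw (hf.comp hν)

/-- The three quantile values `a = F_ν⁻¹(u)`, `x = F_μ⁻¹(u)`, `b = F_ν⁻¹(v)` with `x` strictly
between `a` and `b`. -/
def StrictBetween (a x b : ℝ) : Prop := (a < x ∧ x < b) ∨ (x < a ∧ b < x)

namespace StrictBetween

variable {a x b : ℝ}

theorem weight_eq (h : StrictBetween a x b) : (x - a) / (b - a) = |x - a| * |b - a|⁻¹ := by
  rcases h with h | h
  · rw [abs_of_pos (sub_pos.2 h.1), abs_of_pos (sub_pos.2 (h.1.trans h.2)), div_eq_mul_inv]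
  · rw [abs_of_neg (sub_neg.2 h.1), abs_of_neg (sub_neg.2 (h.2.trans h.1)), div_eq_mul_inv,
      inv_neg, neg_mul_neg]

theorem sub_ne_zero (h : StrictBetween a x b) : b - a ≠ 0 := by
  rcases h with h | h
  · exact (sub_pos.2 (h.1.trans h.2)).ne'
  · exact (sub_neg.2 (h.2.trans h.1)).ne

theorem weight_nonneg (h : StrictBetween a x b) : 0 ≤ (x - a) / (b - a) := by
  rw [h.weight_eq]
  positivity

theorem coweight_nonneg (h : StrictBetween a x b) : 0 ≤ (b - x) / (b - a) := by
  rcases h with h | h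
  · exact div_nonneg (by linarith) (by linarith)
  · exact div_nonneg_of_nonpos (by linarith) (by linarith)

theorem weight_add_coweight (h : StrictBetween a x b) :
    (x - a) / (b - a) + (b - x) / (b - a) = 1 := by
  rw [← add_div, div_eq_one_iff_eq h.sub_ne_zero]
  ring

theorem ofReal_weight_add (h : StrictBetween a x b) :
    ENNReal.ofReal ((x - a) / (b - a)) + ENNReal.ofReal ((b - x) / (b - a)) = 1 := by
  rw [← ENNReal.ofReal_add h.weight_nonneg h.coweight_nonneg, h.weight_add_coweight,
    ENNReal.ofReal_one]

/-- Mean `x` makes the two summands equal, and each is a fraction of `|x - a|`. This is the source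
of the constant `2`. -/
theorem cost_le (h : StrictBetween a x b) :
    ENNReal.ofReal ((x - a) / (b - a)) * ENNReal.ofReal |x - b|
      + ENNReal.ofReal ((b - x) / (b - a)) * ENNReal.ofReal |x - a|
      ≤ 2 * ENNReal.ofReal |x - a| := by
  have h1 := h.weight_nonneg
  have h2 := h.coweight_nonneg
  have h3 : (b - x) / (b - a) ≤ 1 := by linarith [h.weight_add_coweight]
  have h4 : (x - a) / (b - a) * |x - b| = (b - x) / (b - a) * |x - a| := by
    rcases h with h | h
    · rw [abs_of_neg (sub_neg.2 h.2), abs_of_pos (sub_pos.2 h.1)]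
      ring
    · rw [abs_of_pos (sub_pos.2 h.2), abs_of_neg (sub_neg.2 h.1)]
      ring
  rw [← ENNReal.ofReal_mul h1, ← ENNReal.ofReal_mul h2, h4, ← two_mul]
  gcongr
  exact mul_le_of_le_one_left (abs_nonneg _) h3

/-- The mean condition as a balance of upward and downward deviations, which can be integrated in
`[0, ∞]`. -/
theorem mean_eq (h : StrictBetween a x b) :
    ENNReal.ofReal ((x - a) / (b - a)) * ENNReal.ofReal (b - x)
      + ENNReal.ofReal ((b - x) / (b - a)) * ENNReal.ofReal (a - x)
      = ENNReal.ofReal ((x - a) / (b - a)) * ENNReal.ofReal (x - b)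
      + ENNReal.ofReal ((b - x) / (b - a)) * ENNReal.ofReal (x - a) := by
  have h1 := h.weight_nonneg
  have h2 := h.coweight_nonneg
  have h3 : (x - a) / (b - a) * (b - x) = (b - x) / (b - a) * (x - a) := by ring
  have h4 : (b - x) / (b - a) * (a - x) = (x - a) / (b - a) * (x - b) := by ring
  simp_rw [← ENNReal.ofReal_mul h1, ← ENNReal.ofReal_mul h2]
  rw [h3, h4, add_comm]

end StrictBetween

/-! ### Cost, mean and mass balance of a split measure -/

section Split

variable {ρ : Measure ℝ} {u : ℝ}

theorem lintegral_abs_splitMeasure_le (hρ : ρ univ = 1)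
    (h : ∀ᵐ v ∂ρ, StrictBetween (quantile ν u) (quantile μ u) (quantile ν v)) :
    ∫⁻ y, ENNReal.ofReal |quantile μ u - y| ∂splitMeasure μ ν ρ u
      ≤ 2 * ENNReal.ofReal |quantile μ u - quantile ν u| := by
  rw [lintegral_splitMeasure _ _ _ _ (by fun_prop)]
  refine (lintegral_mono_ae (h.mono fun v hv => hv.cost_le)).trans ?_
  rw [lintegral_const, hρ, mul_one]

theorem integral_eq_of_lintegral_eq {η : Measure ℝ} [IsProbabilityMeasure η] {x : ℝ}
    (hi : Integrable (fun y : ℝ => y) η)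
    (h : ∫⁻ y, ENNReal.ofReal (y - x) ∂η = ∫⁻ y, ENNReal.ofReal (x - y) ∂η) :
    ∫ y, y ∂η = x := by
  have h1 := ofReal_integral_sub_add hi (integrable_const (μ := η) x)
  rw [h, sub_self, sub_eq_zero] at h1
  simpa using h1

theorem integrable_of_lintegral_abs_sub {η : Measure ℝ} [IsFiniteMeasure η] {x : ℝ}
    (h : ∫⁻ y, ENNReal.ofReal |x - y| ∂η ≠ ∞) : Integrable (fun y : ℝ => y) η := by
  have h1 : Integrable (fun y : ℝ => x - y) η := by
    refine ⟨by fun_prop, ?_⟩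
    rw [hasFiniteIntegral_iff_norm]
    exact h.lt_top
  refine ((integrable_const (μ := η) x).sub h1).congr (Filter.Eventually.of_forall fun y => ?_)
  simp

theorem lintegral_splitMeasure_mean
    (h : ∀ᵐ v ∂ρ, StrictBetween (quantile ν u) (quantile μ u) (quantile ν v)) :
    ∫⁻ y, ENNReal.ofReal (y - quantile μ u) ∂splitMeasure μ ν ρ u
      = ∫⁻ y, ENNReal.ofReal (quantile μ u - y) ∂splitMeasure μ ν ρ u := by
  rw [lintegral_splitMeasure _ _ _ _ (by fun_prop), lintegral_splitMeasure _ _ _ _ (by fun_prop)]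
  exact lintegral_congr_ae (h.mono fun v hv => hv.mean_eq)

/-- The density `|F_ν⁻¹(v) - F_ν⁻¹(u)|⁻¹`. -/
noncomputable def gapInv (ν : Measure ℝ) (u v : ℝ) : ℝ≥0∞ := ENNReal.ofReal |quantile ν v - quantile ν u|⁻¹

theorem gapInv_comm (ν : Measure ℝ) (u v : ℝ) : gapInv ν u v = gapInv ν v u := by
  rw [gapInv, gapInv, abs_sub_comm]

theorem measurable_gapInv (ν : Measure ℝ) : Measurable fun p : ℝ × ℝ => gapInv ν p.1 p.2 := by
  have := measurable_quantile ν
  unfold gapInv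
  fun_prop

theorem measurable_gapInv_mul (ν : Measure ℝ) (u : ℝ) {f : ℝ → ℝ≥0∞} (hf : Measurable f) :
    Measurable fun v => gapInv ν u v * f v := by
  have hν := measurable_quantile ν
  have h : Measurable fun v => gapInv ν u v := by
    unfold gapInv
    fun_prop
  exact h.mul hf

theorem StrictBetween.abs_mul_gapInv {v : ℝ}
    (h : StrictBetween (quantile ν u) (quantile μ u) (quantile ν v)) :
    ENNReal.ofReal |quantile μ u - quantile ν u| * gapInv ν u v = ENNReal.ofReal
      ((quantile μ u - quantile ν u) / (quantile ν v - quantile ν u)) := by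
  rw [gapInv, ← ENNReal.ofReal_mul (abs_nonneg _), h.weight_eq]

/-- Splitting moves mass `|x - a| / |b - a|` from `a` to `b`. The loss stands on the left because
subtraction in `ℝ≥0∞` truncates. -/
theorem lintegral_splitMeasure_add (hρ : ρ univ = 1)
    (h : ∀ᵐ v ∂ρ, StrictBetween (quantile ν u) (quantile μ u) (quantile ν v)) {f : ℝ → ℝ≥0∞}
    (hf : Measurable f) :
    ∫⁻ y, f y ∂splitMeasure μ ν ρ u
      + ENNReal.ofReal |quantile μ u - quantile ν u| * ∫⁻ v, gapInv ν u v * f (quantile ν u) ∂ρ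
      = f (quantile ν u)
      + ENNReal.ofReal |quantile μ u - quantile ν u| * ∫⁻ v, gapInv ν u v * f (quantile ν v) ∂ρ
      := by
  have hν := measurable_quantile ν
  have hfν : Measurable fun v => f (quantile ν v) := hf.comp hν
  have hc : f (quantile ν u) = ∫⁻ _, f (quantile ν u) ∂ρ := by rw [lintegral_const, hρ, mul_one]
  have hg1 := measurable_gapInv_mul ν u (f := fun _ => f (quantile ν u)) measurable_const
  have hg2 := measurable_gapInv_mul ν u hfν
  rw [lintegral_splitMeasure _ _ _ _ hf, ← lintegral_const_mul _ hg1,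
    ← lintegral_const_mul _ hg2, ← lintegral_add_right _ (hg1.const_mul _)]
  conv_rhs => rw [hc]
  rw [← lintegral_add_left measurable_const]
  refine lintegral_congr_ae (h.mono fun v hv => ?_)
  dsimp only
  rw [← mul_assoc, ← mul_assoc, hv.abs_mul_gapInv, add_assoc, ← add_mul,
    add_comm (ENNReal.ofReal ((quantile ν v - quantile μ u) / _)), hv.ofReal_weight_add, one_mul,
    add_comm]

/-- The moved mass is at most `1`; this finiteness later permits cancellation in `ℝ≥0∞`. -/
theorem abs_mul_lintegral_gapInv_le (hρ : ρ univ = 1)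
    (h : ∀ᵐ v ∂ρ, StrictBetween (quantile ν u) (quantile μ u) (quantile ν v)) {f : ℝ → ℝ≥0∞}
    (hf : Measurable f) (hf1 : ∀ y, f y ≤ 1) (g : ℝ → ℝ) (hg : Measurable g) :
    ENNReal.ofReal |quantile μ u - quantile ν u| * ∫⁻ v, gapInv ν u v * f (g v) ∂ρ ≤ 1 := by
  have hfg : Measurable fun v => f (g v) := hf.comp hg
  rw [← lintegral_const_mul _ (measurable_gapInv_mul ν u hfg), ← hρ, ← lintegral_one]
  refine lintegral_mono_ae (h.mono fun v hv => ?_)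
  rw [← mul_assoc, hv.abs_mul_gapInv]
  exact mul_le_one' (le_of_le_of_eq le_self_add hv.ofReal_weight_add) (hf1 _)

end Split

/-! ### Admissible couplings and their disintegrations -/

/-- Both inequalities come from the chain `F_ν⁻¹(u) < F_μ⁻¹(u) ≤ F_μ⁻¹(v) < F_ν⁻¹(v)`. -/
theorem ae_strictBetween_of_mem_calQ (hγ : gam μ ν ≠ ∞) (hQ : Q ∈ calQ μ ν) :
    ∀ᵐ p ∂Q, (p.1 ∈ Ioo (0 : ℝ) 1 ∧ p.2 ∈ Ioo (0 : ℝ) 1) ∧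
      quantile μ p.1 < quantile ν p.2 ∧ quantile ν p.1 < quantile μ p.2 := by
  obtain ⟨hprob, hfst, hsnd, hlt⟩ := hQ
  have h1 := ae_mem_Uplus hγ
  have h2 := ae_mem_Uminus hγ
  rw [← hfst] at h1
  rw [← hsnd] at h2
  have h3 : ∀ᵐ p ∂Q, p ∈ {p : ℝ × ℝ | p.1 < p.2} :=
    (mem_ae_iff_prob_eq_one (measurableSet_lt measurable_fst measurable_snd)).2 hlt
  filter_upwards [ae_of_ae_map measurable_fst.aemeasurable h1,
    ae_of_ae_map measurable_snd.aemeasurable h2, h3] with p hp1 hp2 hp3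
  have hm := quantile_monotoneOn μ hp1.1 hp2.1 (le_of_lt hp3)
  exact ⟨⟨hp1.1, hp2.1⟩, lt_of_le_of_lt hm hp2.2, lt_of_lt_of_le hp1.2 hm⟩

theorem measure_eq_one_of_ae_mem {ρ : Measure ℝ} {s t : Set ℝ} (hρ : ρ univ ≤ 1) (ht : ρ t = 1)
    (hs : MeasurableSet s) (h : ∀ᵐ v ∂ρ, v ∈ s) : ρ s = 1 := by
  have : IsProbabilityMeasure ρ := ⟨le_antisymm hρ (ht ▸ measure_mono (subset_univ t))⟩
  exact (mem_ae_iff_prob_eq_one hs).1 h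

theorem univ_eq_one_and_ae_mem {ρ : Measure ℝ} {s : Set ℝ} (hρ : ρ univ ≤ 1) (hs : ρ s = 1)
    (hm : MeasurableSet s) : ρ univ = 1 ∧ ∀ᵐ v ∂ρ, v ∈ s := by
  have : IsProbabilityMeasure ρ := ⟨le_antisymm hρ (hs ▸ measure_mono (subset_univ s))⟩
  exact ⟨measure_univ, (mem_ae_iff_prob_eq_one hm).2 hs⟩

theorem ae_ae_piPlus (D : Disintegration μ ν Q) {p : ℝ × ℝ → Prop} (h : ∀ᵐ x ∂Q, p x) :
    ∀ᵐ u ∂plusMarginal μ ν, ∀ᵐ v ∂D.piPlus u, p (u, v) := by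
  have hs : SFinite (plusMarginal μ ν) := by
    unfold plusMarginal
    infer_instance
  exact Measure.ae_ae_of_ae_compProd (D.eq_plus ▸ h)

theorem ae_ae_piMinus (D : Disintegration μ ν Q) {p : ℝ × ℝ → Prop} (h : ∀ᵐ x ∂Q, p x) :
    ∀ᵐ v ∂minusMarginal μ ν, ∀ᵐ u ∂D.piMinus v, p (u, v) := by
  have hs : SFinite (minusMarginal μ ν) := by
    unfold minusMarginal
    infer_instance
  have h' := ae_of_ae_map measurable_swap.aemeasurable (D.eq_minus ▸ h)
  exact Measure.ae_ae_of_ae_compProd h'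

theorem ae_mem_goodPlus (hγ : gam μ ν ≠ ∞) (hQ : Q ∈ calQ μ ν) (D : Disintegration μ ν Q) :
    ∀ᵐ u ∂volume.restrict (Uplus μ ν), u ∈ goodPlus μ ν D.piPlus := by
  have h := (ae_plusMarginal_iff hγ).1 (ae_ae_piPlus D (ae_strictBetween_of_mem_calQ hγ hQ))
  filter_upwards [h, D.plus_eq_one, ae_restrict_mem (measurableSet_Uplus μ ν)] with u h1 h2 h3
  exact ⟨h3, measure_eq_one_of_ae_mem (D.plus_le_one u) h2 (measurableSet_Ioo.inter
    (measurableSet_lt measurable_const (measurable_quantile ν)))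
    (h1.mono fun v hv => ⟨hv.1.2, hv.2.1⟩)⟩

theorem ae_mem_goodMinus (hγ : gam μ ν ≠ ∞) (hQ : Q ∈ calQ μ ν) (D : Disintegration μ ν Q) :
    ∀ᵐ u ∂volume.restrict (Uminus μ ν), u ∈ goodMinus μ ν D.piMinus := by
  have h := (ae_minusMarginal_iff hγ).1 (ae_ae_piMinus D (ae_strictBetween_of_mem_calQ hγ hQ))
  filter_upwards [h, D.minus_eq_one, ae_restrict_mem (measurableSet_Uminus μ ν)] with u h1 h2 h3
  exact ⟨h3, measure_eq_one_of_ae_mem (D.minus_le_one u) h2 (measurableSet_Ioo.inter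
    (measurableSet_lt (measurable_quantile ν) measurable_const))
    (h1.mono fun v hv => ⟨hv.1.1, hv.2.2⟩)⟩

theorem ae_mem_good_or_eq (hγ : gam μ ν ≠ ∞) (hQ : Q ∈ calQ μ ν) (D : Disintegration μ ν Q) :
    ∀ᵐ u ∂unitLebesgue, u ∈ goodPlus μ ν D.piPlus ∨ u ∈ goodMinus μ ν D.piMinus ∨
      quantile μ u = quantile ν u := by
  have h1 := ae_mem_goodPlus hγ hQ D
  have h2 := ae_mem_goodMinus hγ hQ D
  rw [ae_restrict_iff' (measurableSet_Uplus μ ν)] at h1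
  rw [ae_restrict_iff' (measurableSet_Uminus μ ν)] at h2
  rw [ae_restrict_iff' measurableSet_Ioo]
  filter_upwards [h1, h2] with u hu1 hu2 hu
  rcases lt_trichotomy (quantile μ u) (quantile ν u) with h | h | h
  · exact Or.inr (Or.inl (hu2 ⟨hu, h⟩))
  · exact Or.inr (Or.inr h)
  · exact Or.inl (hu1 ⟨hu, h⟩)

/-! ### Cost, mean and second marginal of `mTilde` -/

section Kernel

variable (D : Disintegration μ ν Q) {u : ℝ}

theorem goodPlus_facts (hu : u ∈ goodPlus μ ν D.piPlus) : D.piPlus u univ = 1 ∧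
    ∀ᵐ v ∂D.piPlus u, StrictBetween (quantile ν u) (quantile μ u) (quantile ν v) := by
  obtain ⟨h1, h2⟩ := univ_eq_one_and_ae_mem (D.plus_le_one u) hu.2
    (measurableSet_Ioo.inter (measurableSet_lt measurable_const (measurable_quantile ν)))
  exact ⟨h1, h2.mono fun v hv => Or.inl ⟨hu.1.2, hv.2⟩⟩

theorem goodMinus_facts (hu : u ∈ goodMinus μ ν D.piMinus) : D.piMinus u univ = 1 ∧
    ∀ᵐ v ∂D.piMinus u, StrictBetween (quantile ν u) (quantile μ u) (quantile ν v) := by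
  obtain ⟨h1, h2⟩ := univ_eq_one_and_ae_mem (D.minus_le_one u) hu.2
    (measurableSet_Ioo.inter (measurableSet_lt (measurable_quantile ν) measurable_const))
  exact ⟨h1, h2.mono fun v hv => Or.inr ⟨hu.1.2, hv.2⟩⟩

theorem mTilde_of_mem_goodPlus (hu : u ∈ goodPlus μ ν D.piPlus) :
    mTilde D u = splitMeasure μ ν (D.piPlus u) u := if_pos hu

theorem mTilde_of_mem_goodMinus (hu : u ∈ goodMinus μ ν D.piMinus) :
    mTilde D u = splitMeasure μ ν (D.piMinus u) u :=
  (if_neg fun h => lt_asymm h.1.2 hu.1.2).trans (if_pos hu)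

theorem mTilde_of_notMem (h1 : u ∉ goodPlus μ ν D.piPlus) (h2 : u ∉ goodMinus μ ν D.piMinus) :
    mTilde D u = Measure.dirac (quantile ν u) :=
  (if_neg h1).trans (if_neg h2)

theorem mTilde_of_eq (h : quantile μ u = quantile ν u) :
    mTilde D u = Measure.dirac (quantile ν u) :=
  mTilde_of_notMem D (fun hu => hu.1.2.ne' h) (fun hu => hu.1.2.ne h)

theorem lintegral_abs_mTilde_le (u : ℝ) :
    ∫⁻ y, ENNReal.ofReal |quantile μ u - y| ∂mTilde D u
      ≤ 2 * ENNReal.ofReal |quantile μ u - quantile ν u| := by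
  by_cases h1 : u ∈ goodPlus μ ν D.piPlus
  · obtain ⟨h, h'⟩ := goodPlus_facts D h1
    rw [mTilde_of_mem_goodPlus D h1]
    exact lintegral_abs_splitMeasure_le h h'
  by_cases h2 : u ∈ goodMinus μ ν D.piMinus
  · obtain ⟨h, h'⟩ := goodMinus_facts D h2
    rw [mTilde_of_mem_goodMinus D h2]
    exact lintegral_abs_splitMeasure_le h h'
  -- The fallback Dirac mass costs just `|x - a|`, so the bound holds at every `u`.
  rw [mTilde_of_notMem D h1 h2, lintegral_dirac, two_mul]
  exact le_self_add

theorem cost_MQ_le [IsProbabilityMeasure μ] [IsProbabilityMeasure ν] :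
    cost (MQ D) ≤ 2 * W₁ μ ν := by
  have hμ := measurable_quantile μ
  have hν := measurable_quantile ν
  rw [cost, MQ, lintegral_compProd_lineKernel _ _ (by fun_prop)]
  refine (lintegral_mono fun u => lintegral_abs_mTilde_le D u).trans ?_
  rw [lintegral_const_mul _ (by fun_prop)]
  gcongr
  exact lintegral_abs_quantile_sub_le_W₁ μ ν

theorem ae_integral_mTilde (hγ : gam μ ν ≠ ∞) (hQ : Q ∈ calQ μ ν) :
    ∀ᵐ u ∂unitLebesgue, ∫ y, y ∂mTilde D u = quantile μ u := by
  have hi : ∀ u, Integrable (fun y : ℝ => y) (mTilde D u) := fun u =>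
    integrable_of_lintegral_abs_sub ((lintegral_abs_mTilde_le D u).trans_lt
      (ENNReal.mul_lt_top ENNReal.ofNat_lt_top ENNReal.ofReal_lt_top)).ne
  filter_upwards [ae_mem_good_or_eq hγ hQ D] with u hu
  rcases hu with hu | hu | hu
  · refine integral_eq_of_lintegral_eq (hi u) ?_
    rw [mTilde_of_mem_goodPlus D hu]
    exact lintegral_splitMeasure_mean (goodPlus_facts D hu).2
  · refine integral_eq_of_lintegral_eq (hi u) ?_
    rw [mTilde_of_mem_goodMinus D hu]
    exact lintegral_splitMeasure_mean (goodMinus_facts D hu).2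
  · rw [mTilde_of_eq D hu, integral_dirac, hu]

/-- Together with `lintegral_piMinus`, this expresses the transfers of both kernels as integrals
against the same `Q`. -/
theorem lintegral_piPlus (h0 : gam μ ν ≠ 0) (hγ : gam μ ν ≠ ∞) {φ : ℝ × ℝ → ℝ≥0∞}
    (hφ : Measurable φ) :
    ∫⁻ u, ENNReal.ofReal (quantile μ u - quantile ν u) * ∫⁻ v, φ (u, v) ∂D.piPlus u ∂unitLebesgue
      = gam μ ν * ∫⁻ p, φ p ∂Q := by
  have hs : SFinite (plusMarginal μ ν) := by
    unfold plusMarginal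
    infer_instance
  have hm : Measurable fun u => ∫⁻ v, φ (u, v) ∂D.piPlus u := hφ.lintegral_kernel_prod_right'
  have e : ∫⁻ p, φ p ∂Q = ∫⁻ p, φ p ∂(plusMarginal μ ν ⊗ₘ D.piPlus) :=
    congrArg (fun R : Measure (ℝ × ℝ) => lintegral R φ) D.eq_plus
  rw [e, Measure.lintegral_compProd hφ, plusMarginal,
    lintegral_withDensity_eq_lintegral_mul _ (measurable_plusDensity μ ν) hm,
    ← lintegral_const_mul _ ((measurable_plusDensity μ ν).mul hm)]
  refine lintegral_congr fun u => ?_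
  rw [Pi.mul_apply, ← mul_assoc, ENNReal.mul_div_cancel h0 hγ]

theorem lintegral_piMinus (h0 : gam μ ν ≠ 0) (hγ : gam μ ν ≠ ∞) {φ : ℝ × ℝ → ℝ≥0∞}
    (hφ : Measurable φ) :
    ∫⁻ u, ENNReal.ofReal (quantile ν u - quantile μ u) * ∫⁻ v, φ (u, v) ∂D.piMinus u ∂unitLebesgue
      = gam μ ν * ∫⁻ p, φ p.swap ∂Q := by
  have hs : SFinite (minusMarginal μ ν) := by
    unfold minusMarginal
    infer_instance
  have hm : Measurable fun u => ∫⁻ v, φ (u, v) ∂D.piMinus u := hφ.lintegral_kernel_prod_right'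
  have e : ∫⁻ p, φ p.swap ∂Q
      = ∫⁻ p, φ p.swap ∂((minusMarginal μ ν ⊗ₘ D.piMinus).map Prod.swap) :=
    congrArg (fun R : Measure (ℝ × ℝ) => lintegral R fun p => φ p.swap) D.eq_minus
  have hφs : Measurable fun p : ℝ × ℝ => φ p.swap := hφ.comp measurable_swap
  rw [e, lintegral_map hφs measurable_swap]
  simp_rw [Prod.swap_swap]
  rw [Measure.lintegral_compProd hφ, minusMarginal,
    lintegral_withDensity_eq_lintegral_mul _ (measurable_minusDensity μ ν) hm,
    ← lintegral_const_mul _ ((measurable_minusDensity μ ν).mul hm)]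
  refine lintegral_congr fun u => ?_
  rw [Pi.mul_apply, ← mul_assoc, ENNReal.mul_div_cancel h0 hγ]

theorem ofReal_abs_of_pos_left {x y : ℝ} (h : y < x) : ENNReal.ofReal |x - y|
    = ENNReal.ofReal (x - y) ∧ ENNReal.ofReal (y - x) = 0 :=
  ⟨by rw [abs_of_pos (sub_pos.2 h)], ENNReal.ofReal_of_nonpos (sub_nonpos.2 h.le)⟩

/-- One balance identity for all three branches: at each `u` at most one of the two positive parts
is nonzero. -/
theorem ae_lintegral_mTilde_add (hγ : gam μ ν ≠ ∞) (hQ : Q ∈ calQ μ ν) {f : ℝ → ℝ≥0∞}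
    (hf : Measurable f) : ∀ᵐ u ∂unitLebesgue,
    ∫⁻ y, f y ∂mTilde D u
      + (ENNReal.ofReal (quantile μ u - quantile ν u) *
          ∫⁻ v, gapInv ν u v * f (quantile ν u) ∂D.piPlus u
        + ENNReal.ofReal (quantile ν u - quantile μ u) *
          ∫⁻ v, gapInv ν u v * f (quantile ν u) ∂D.piMinus u)
      = f (quantile ν u)
      + (ENNReal.ofReal (quantile μ u - quantile ν u) *
          ∫⁻ v, gapInv ν u v * f (quantile ν v) ∂D.piPlus u
        + ENNReal.ofReal (quantile ν u - quantile μ u) *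
          ∫⁻ v, gapInv ν u v * f (quantile ν v) ∂D.piMinus u) := by
  filter_upwards [ae_mem_good_or_eq hγ hQ D] with u hu
  rcases hu with hu | hu | hu
  · obtain ⟨h, h'⟩ := goodPlus_facts D hu
    obtain ⟨e1, e2⟩ := ofReal_abs_of_pos_left hu.1.2
    rw [mTilde_of_mem_goodPlus D hu, e2, zero_mul, zero_mul, add_zero, add_zero, ← e1]
    exact lintegral_splitMeasure_add h h' hf
  · obtain ⟨h, h'⟩ := goodMinus_facts D hu
    obtain ⟨e1, e2⟩ := ofReal_abs_of_pos_left hu.1.2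
    rw [mTilde_of_mem_goodMinus D hu, e2, zero_mul, zero_mul, zero_add, zero_add, ← e1,
      abs_sub_comm]
    exact lintegral_splitMeasure_add h h' hf
  · rw [mTilde_of_eq D hu, lintegral_dirac' _ hf, hu, sub_self, ENNReal.ofReal_zero, zero_mul,
      zero_mul]
    simp

theorem ae_plus_mul_lintegral_le (hγ : gam μ ν ≠ ∞) (hQ : Q ∈ calQ μ ν) {f : ℝ → ℝ≥0∞}
    (hf : Measurable f) (hf1 : ∀ y, f y ≤ 1) {g : ℝ → ℝ → ℝ} (hg : ∀ u, Measurable (g u)) :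
    ∀ᵐ u ∂unitLebesgue, ENNReal.ofReal (quantile μ u - quantile ν u) *
      ∫⁻ v, gapInv ν u v * f (g u v) ∂D.piPlus u ≤ 1 := by
  filter_upwards [ae_mem_good_or_eq hγ hQ D] with u hu
  rcases hu with hu | hu | hu
  · obtain ⟨h, h'⟩ := goodPlus_facts D hu
    rw [← (ofReal_abs_of_pos_left hu.1.2).1]
    exact abs_mul_lintegral_gapInv_le h h' hf hf1 (g u) (hg u)
  · rw [(ofReal_abs_of_pos_left hu.1.2).2, zero_mul]
    exact zero_le
  · rw [hu, sub_self, ENNReal.ofReal_zero, zero_mul]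
    exact zero_le

theorem bind_mTilde [IsProbabilityMeasure ν] (h0 : gam μ ν ≠ 0) (hγ : gam μ ν ≠ ∞)
    (hQ : Q ∈ calQ μ ν) : unitLebesgue.bind (mTilde D) = ν := by
  have hμ := measurable_quantile μ
  have hν := measurable_quantile ν
  ext s hs
  have hf : Measurable (s.indicator (1 : ℝ → ℝ≥0∞)) := measurable_one.indicator hs
  set f := s.indicator (1 : ℝ → ℝ≥0∞)
  have hf1 : ∀ y, f y ≤ 1 := indicator_le_self' (fun _ _ => zero_le)
  have hφ : Measurable fun p : ℝ × ℝ => gapInv ν p.1 p.2 * f (quantile ν p.1) :=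
    (measurable_gapInv ν).mul (hf.comp (hν.comp measurable_fst))
  have hψ : Measurable fun p : ℝ × ℝ => gapInv ν p.1 p.2 * f (quantile ν p.2) :=
    (measurable_gapInv ν).mul (hf.comp (hν.comp measurable_snd))
  have hp : ∀ {φ : ℝ × ℝ → ℝ≥0∞}, Measurable φ → Measurable fun u =>
      ENNReal.ofReal (quantile μ u - quantile ν u) * ∫⁻ v, φ (u, v) ∂D.piPlus u :=
    fun h => Measurable.mul (by fun_prop) h.lintegral_kernel_prod_right'
  have hm : ∀ {φ : ℝ × ℝ → ℝ≥0∞}, Measurable φ → Measurable fun u =>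
      ENNReal.ofReal (quantile ν u - quantile μ u) * ∫⁻ v, φ (u, v) ∂D.piMinus u :=
    fun h => Measurable.mul (by fun_prop) h.lintegral_kernel_prod_right'
  have key := lintegral_congr_ae (ae_lintegral_mTilde_add D hγ hQ hf)
  have pφ := hp hφ
  have mφ := hm hφ
  have pψ := hp hψ
  have mψ := hm hψ
  dsimp only at pφ mφ pψ mψ
  rw [lintegral_add_right _ (pφ.fun_add mφ), lintegral_add_right _ (pψ.fun_add mψ),
    lintegral_add_left pφ, lintegral_add_left pψ] at key
  -- Finiteness for the plus kernel suffices: the minus terms become the same two `Q`-integrals with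
  -- roles exchanged.
  have hX := lintegral_mono_ae (ae_plus_mul_lintegral_le D hγ hQ hf hf1
    (g := fun u _ => quantile ν u) fun u => measurable_const)
  have hY := lintegral_mono_ae (ae_plus_mul_lintegral_le D hγ hQ hf hf1
    (g := fun _ v => quantile ν v) fun u => hν)
  rw [lintegral_one, measure_univ] at hX hY
  have eX := lintegral_piPlus D h0 hγ hφ
  have eY := lintegral_piPlus D h0 hγ hψ
  have eX' := lintegral_piMinus D h0 hγ hψ
  have eY' := lintegral_piMinus D h0 hγ hφ
  -- Symmetry of the gap makes mass lost by one kernel equal mass gained by the other, so the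
  -- correction terms of `key` coincide.
  simp only [Prod.fst_swap, Prod.snd_swap, gapInv_comm ν (Prod.snd _)] at eX eY eX' eY'
  rw [eX] at hX
  rw [eY] at hY
  rw [eX, eY, eX', eY', add_comm (gam μ ν * ∫⁻ p, gapInv ν p.1 p.2 * f (quantile ν p.2) ∂Q)] at key
  have e := (ENNReal.add_left_inj (ENNReal.add_ne_top.2
    ⟨(hX.trans_lt ENNReal.one_lt_top).ne, (hY.trans_lt ENNReal.one_lt_top).ne⟩)).1 key
  rw [Measure.bind_apply hs (mTilde D).measurable.aemeasurable]
  simp_rw [f, lintegral_indicator_one hs] at e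
  rw [e, ← lintegral_map (measurable_one.indicator hs) hν, map_quantile, lintegral_indicator_one hs]

theorem MQ_mem_martingaleCouplings [IsProbabilityMeasure μ] [IsProbabilityMeasure ν]
    (hμ : FiniteFirstMoment μ) (hν : FiniteFirstMoment ν) (h : StrictConvexOrder μ ν)
    (hQ : Q ∈ calQ μ ν) : MQ D ∈ martingaleCouplings μ ν := by
  have h0 := gam_ne_zero hμ hν h
  have hγ := gam_ne_top hμ hν
  have hb := bind_mTilde D h0 hγ hQ
  refine ⟨⟨Measure.fst_compProd _ _, ?_⟩, lineKernel μ (mTilde D), inferInstance, rfl, ?_⟩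
  · rw [MQ, snd_compProd_lineKernel, hb]
  · exact ae_integral_lineKernel μ hμ.2 _ (hb.symm ▸ hν.2) (ae_integral_mTilde D hγ hQ)

end Kernel

theorem M₁_le_two_mul_W₁ (hμ : FiniteFirstMoment μ) (hν : FiniteFirstMoment ν)
    (h : StrictConvexOrder μ ν) : M₁ μ ν ≤ 2 * W₁ μ ν := by
  have := hμ.1
  have := hν.1
  obtain ⟨Q, hQ⟩ := calQ_nonempty hμ hν h
  obtain ⟨D⟩ := nonempty_disintegration (gam_ne_top hμ hν) hQ
  exact (iInf₂_le _ (MQ_mem_martingaleCouplings D hμ hν h hQ)).trans (cost_MQ_le D)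

/-! ### Symmetric two-point marginals -/

theorem inv_two_add_inv_two_smul {α : Type*} [MeasurableSpace α] (x y : α) :
    IsProbabilityMeasure ((2 : ℝ≥0∞)⁻¹ • Measure.dirac x + (2 : ℝ≥0∞)⁻¹ • Measure.dirac y) := by
  refine ⟨?_⟩
  simp [ENNReal.inv_two_add_inv_two]

instance (a : ℝ) : IsProbabilityMeasure (symmTwoPoint a) := inv_two_add_inv_two_smul _ _

theorem integrable_symmTwoPoint (a : ℝ) (f : ℝ → ℝ) : Integrable f (symmTwoPoint a) :=
  ((integrable_dirac (by simp)).smul_measure (by simp)).add_measure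
    ((integrable_dirac (by simp)).smul_measure (by simp))

theorem integral_symmTwoPoint (a : ℝ) (f : ℝ → ℝ) :
    ∫ x, f x ∂symmTwoPoint a = (f (-a) + f a) / 2 := by
  rw [symmTwoPoint, integral_add_measure ((integrable_dirac (by simp)).smul_measure (by simp))
    ((integrable_dirac (by simp)).smul_measure (by simp)), integral_smul_measure,
    integral_smul_measure, integral_dirac, integral_dirac]
  simp only [ENNReal.toReal_inv, ENNReal.toReal_ofNat, smul_eq_mul]
  ring

theorem finiteFirstMoment_symmTwoPoint (a : ℝ) : FiniteFirstMoment (symmTwoPoint a) :=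
  ⟨inferInstance, integrable_symmTwoPoint a _⟩

theorem ae_symmTwoPoint_iff (a : ℝ) {p : ℝ → Prop} :
    (∀ᵐ x ∂symmTwoPoint a, p x) ↔ p (-a) ∧ p a := by
  simp [symmTwoPoint, ae_add_measure_iff, ae_dirac_eq]

theorem strictConvexOrder_symmTwoPoint {a : ℝ} (h0 : 0 < a) (h1 : a < 1) :
    StrictConvexOrder (symmTwoPoint a) (symmTwoPoint 1) := by
  refine ⟨fun f hf _ => ⟨integrable_symmTwoPoint a f, ?_⟩, fun h => ?_⟩
  · rw [integral_symmTwoPoint, integral_symmTwoPoint]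
    -- `a` and `-a` are the convex combinations of `±1` with weights `(1 ± a) / 2`; adding the two
    -- Jensen inequalities gives the claim.
    have hp : 0 ≤ (1 + a) / 2 := by linarith
    have hq : 0 ≤ (1 - a) / 2 := by linarith
    have e1 := hf.2 (mem_univ (-1)) (mem_univ 1) hp hq (by ring)
    have e2 := hf.2 (mem_univ (-1)) (mem_univ 1) hq hp (by ring)
    simp only [smul_eq_mul] at e1 e2
    ring_nf at e1 e2 ⊢
    linarith
  · have e := (ae_symmTwoPoint_iff a (p := fun x => x ≠ 1)).2 ⟨by linarith, h1.ne⟩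
    rw [h, ae_symmTwoPoint_iff] at e
    exact e.2 rfl

/-- Send `-a` to `-1` and `a` to `1`. -/
theorem W₁_symmTwoPoint_le {a : ℝ} (h1 : a < 1) :
    W₁ (symmTwoPoint a) (symmTwoPoint 1) ≤ ENNReal.ofReal (1 - a) := by
  refine (iInf₂_le ((2 : ℝ≥0∞)⁻¹ • Measure.dirac (-a, -1) + (2 : ℝ≥0∞)⁻¹ • Measure.dirac (a, 1))
    ⟨?_, ?_⟩).trans ?_
  · rw [cost, lintegral_add_measure, lintegral_smul_measure, lintegral_smul_measure,
      lintegral_dirac, lintegral_dirac]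
    dsimp only
    rw [show -a - -1 = 1 - a by ring, abs_sub_comm a, abs_of_pos (sub_pos.2 h1), ← add_smul,
      ENNReal.inv_two_add_inv_two, one_smul]
  · rw [Measure.map_add _ _ measurable_fst, Measure.map_smul, Measure.map_smul,
      Measure.map_dirac' measurable_fst, Measure.map_dirac' measurable_fst]
    rfl
  · rw [Measure.map_add _ _ measurable_snd, Measure.map_smul, Measure.map_smul,
      Measure.map_dirac' measurable_snd, Measure.map_dirac' measurable_snd]
    rfl

/-- For `|x| < 1` and `y = ±1` the cost `|x - y| = 1 - x * y` is affine in `y`, so the martingale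
condition fixes its conditional mean at `1 - x²`. -/
theorem ofReal_one_sub_sq_le_M₁ {a : ℝ} (h0 : 0 < a) (h1 : a < 1) :
    ENNReal.ofReal (1 - a ^ 2) ≤ M₁ (symmTwoPoint a) (symmTwoPoint 1) := by
  refine le_iInf₂ fun M hM => ?_
  obtain ⟨⟨-, hsnd⟩, m, hm, rfl, hmart⟩ := hM
  have hy : ∀ᵐ y ∂symmTwoPoint 1, y = -1 ∨ y = 1 := by
    rw [ae_symmTwoPoint_iff]
    simp
  rw [← hsnd] at hy
  have hxy := Measure.ae_ae_of_ae_compProd (ae_of_ae_map measurable_snd.aemeasurable hy)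
  have hx : ∀ᵐ x ∂symmTwoPoint a, x ^ 2 = a ^ 2 ∧ -1 < x ∧ x < 1 := by
    rw [ae_symmTwoPoint_iff]
    exact ⟨⟨by ring, by linarith, by linarith⟩, rfl, by linarith, h1⟩
  rw [cost, Measure.lintegral_compProd (by fun_prop)]
  have hc : ENNReal.ofReal (1 - a ^ 2) = ∫⁻ _, ENNReal.ofReal (1 - a ^ 2) ∂symmTwoPoint a := by
    rw [lintegral_const, measure_univ, mul_one]
  rw [hc]
  refine lintegral_mono_ae ?_
  filter_upwards [hx, hxy, hmart] with x hx hxy hmart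
  have habs : ∀ᵐ y ∂m x, |x - y| = 1 - x * y := by
    filter_upwards [hxy] with y hy
    rcases hy with hy | hy
    · rw [show y = -1 from hy, abs_of_pos (by linarith)]
      ring
    · rw [show y = 1 from hy, abs_of_neg (by linarith)]
      ring
  have hi : Integrable (fun y => 1 - x * y) (m x) :=
    (integrable_const 1).sub (hmart.1.const_mul x)
  have hint : ∫ y, (1 - x * y) ∂m x = 1 - a ^ 2 := by
    rw [integral_sub (integrable_const 1) (hmart.1.const_mul x), integral_const_mul, hmart.2,
      integral_const, ← hx.1]
    simp only [measureReal_def, measure_univ, ENNReal.toReal_one, smul_eq_mul]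
    ring
  rw [← hint, ofReal_integral_eq_lintegral_ofReal hi (habs.mono fun y hy => (abs_nonneg (x - y)).trans hy.le)]
  exact (lintegral_congr_ae (habs.mono fun y hy => by simp only [hy])).ge

theorem exists_symmTwoPoint_lt {c : ℝ≥0∞} (hc : c < 2) : ∃ a : ℝ, 0 < a ∧ a < 1 ∧
    c * W₁ (symmTwoPoint a) (symmTwoPoint 1) < M₁ (symmTwoPoint a) (symmTwoPoint 1) := by
  lift c to NNReal using (hc.trans ENNReal.ofNat_lt_top).ne
  have hc2 : (c : ℝ) < 2 := by exact_mod_cast hc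
  have hc0 : 0 ≤ (c : ℝ) := c.2
  -- The choice `a = (c + 2) / 4` lies in `(0, 1)` and satisfies `1 + a > c`, both because `c < 2`.
  have h0 : 0 < ((c : ℝ) + 2) / 4 := by linarith
  have h1 : ((c : ℝ) + 2) / 4 < 1 := by linarith
  refine ⟨_, h0, h1, ?_⟩
  refine lt_of_le_of_lt (mul_le_mul_right (W₁_symmTwoPoint_le h1) _)
    (lt_of_lt_of_le ?_ (ofReal_one_sub_sq_le_M₁ h0 h1))
  rw [← ENNReal.ofReal_coe_nnreal, ← ENNReal.ofReal_mul hc0]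
  refine (ENNReal.ofReal_lt_ofReal_iff (by nlinarith)).2 (by nlinarith)

theorem iSup_M₁_div_W₁ :
    (⨆ (μ : Measure ℝ) (ν : Measure ℝ) (_ : FiniteFirstMoment μ) (_ : FiniteFirstMoment ν)
      (_ : StrictConvexOrder μ ν), M₁ μ ν / W₁ μ ν) = 2 := by
  refine le_antisymm (iSup₂_le fun μ ν => iSup₂_le fun hμ hν => iSup_le fun h =>
    ENNReal.div_le_of_le_mul (M₁_le_two_mul_W₁ hμ hν h)) (le_of_forall_lt fun c hc => ?_)
  obtain ⟨c', hcc', hc'⟩ := exists_between hc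
  obtain ⟨a, h0, h1, h⟩ := exists_symmTwoPoint_lt hc'
  have hW : W₁ (symmTwoPoint a) (symmTwoPoint 1) ≠ ∞ :=
    ((W₁_symmTwoPoint_le h1).trans_lt ENNReal.ofReal_lt_top).ne
  refine hcc'.trans_le (le_iSup₂_of_le (symmTwoPoint a) (symmTwoPoint 1)
    (le_iSup₂_of_le (finiteFirstMoment_symmTwoPoint a) (finiteFirstMoment_symmTwoPoint 1)
      (le_iSup_of_le (strictConvexOrder_symmTwoPoint h0 h1) ?_)))
  -- Division in `ℝ≥0∞` is harmless here: the numerator is nonzero and the denominator finite.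
  exact (ENNReal.le_div_iff_mul_le (Or.inr (pos_of_gt h).ne') (Or.inl hW)).2 h.le

end MartingaleStability

theorem mainTheorem1 :
    (∀ (μ ν : Measure ℝ) [IsProbabilityMeasure μ] [IsProbabilityMeasure ν],
      FiniteFirstMoment μ → FiniteFirstMoment ν → StrictConvexOrder μ ν →
        (calQ μ ν).Nonempty ∧
        (∀ Q ∈ calQ μ ν, Nonempty (Disintegration μ ν Q) ∧
          ∀ D : Disintegration μ ν Q, cost (MQ D) ≤ 2 * W₁ μ ν) ∧
        M₁ μ ν ≤ 2 * W₁ μ ν) ∧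
    (⨆ (μ : Measure ℝ) (ν : Measure ℝ) (_ : FiniteFirstMoment μ) (_ : FiniteFirstMoment ν)
      (_ : StrictConvexOrder μ ν), M₁ μ ν / W₁ μ ν) = 2 ∧
    (∀ c : ℝ≥0∞, c < 2 → ∃ a b : ℝ, 0 < a ∧ a < b ∧
      StrictConvexOrder (symmTwoPoint a) (symmTwoPoint b) ∧
      c * W₁ (symmTwoPoint a) (symmTwoPoint b) < M₁ (symmTwoPoint a) (symmTwoPoint b)) := by
  refine ⟨fun μ ν _ _ hμ hν h => ⟨calQ_nonempty hμ hν h, fun Q hQ =>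
    ⟨nonempty_disintegration (gam_ne_top hμ hν) hQ, fun D => cost_MQ_le D⟩,
    M₁_le_two_mul_W₁ hμ hν h⟩, iSup_M₁_div_W₁, fun c hc => ?_⟩
  obtain ⟨a, h0, h1, h⟩ := exists_symmTwoPoint_lt hc
  exact ⟨a, 1, h0, h1, strictConvexOrder_symmTwoPoint h0 h1, h⟩
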